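/- All algorithms are deterministic programs for a word RAM with words of $O(\log s)$ bits, where $s$ is the size parameter ($n$ resp. $N$ below), unit cost per instruction. **OV hypothesis.** In $K$-OV the input is a list $L$ of $n$ vectors in $\{0,1\}^d$ with $d=n^{o(1)}$, and one has to decide whether there are $v_1,\dots,v_K\in L$ (repetitions allowed) with $v_1[j]\cdot v_2[j]\cdots v_K[j]=0$ for all coordinates $j$. The $K$-OV hypothesis says that $K$-OV requires $n^{K-o(1)}$ time, that is: for no constants $\varepsilon,\delta>0$ is there an algorithm that solves $K$-OV for all sufficiently large $n$ and all $d\le n^{\delta}$ in time $O(n^{K-\varepsilon})$. **Straight-line programs (SLPs).** An SLP over an alphabet $\Sigma$ is a finite sequence of symbols containing $\Sigma$, with a nonempty production $A\to B_1\cdots B_r$ for each $A\notin\Sigma$ in which all $B_i$ precede $A$, and with a start symbol. It represents the string over $\Sigma$ to which the start symbol expands. Its size is the number of symbols plus the total length of the productions. **$k$-Shift Distance.** Given strings $X_1,\dots,X_k\in\Sigma^N$, with indices read modulo $N$, compute $$k\text{-}SD(X_1,\dots,X_k)=\max_{\Delta_1,\dots,\Delta_{k-1}\in\{0,\dots,N-1\}}\#\bigl\{i\in\{1,\dots,N\}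 : X_1[i+\Delta_1]=\cdots=X_{k-1}[i+\Delta_{k-1}]=X_k[i]\bigr\}.$$ **Theorem.** Let $a\ge 1$ and $k\ge 2$ be constant integers, and assume the $(a(k-1))$-OV hypothesis. Then $k$-Shift Distance requires $N^{k-1-o(1)}$ time even when the strings compress to size $N^{1/a+o(1)}$ over an alphabet of size $O(1)$. That is, there is a constant $\sigma$ (depending on $a$ and $k$ only) such that for all $\varepsilon,\delta>0$ there is no algorithm that, for all sufficiently large $N$, computes $k\text{-}SD(X_1,\dots,X_k)$ in time $O(N^{k-1-\varepsilon})$ for all strings $X_1,\dots,X_k$ of length $N$ over an alphabet of size $\sigma$ such that each $X_i$ is represented by an SLP of size between $N^{1/a-\delta}$ and $N^{1/a+\delta}$. This holds both when the algorithm is given the strings themselves and when it is given such SLPs of the strings. -/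

import Mathlib

namespace KSD

/-! ### Word RAM -/

/-- The binary operations on words that the machine performs in one step (subtraction is truncated,
division by zero gives zero; `shl` and `shr` shift by the second operand). -/
inductive BinOp where
  | add | sub | mul | div | mod | land | lor | xor | shl | shr

/-- The value of a binary operation. -/
def BinOp.eval : BinOp → ℕ → ℕ → ℕ
  | .add, x, y => x + y
  | .sub, x, y => x - y
  | .mul, x, y => x * y
  | .div, x, y => x / y
  | .mod, x, y => x % y
  | .land, x, y => x &&& y
  | .lor, x, y => x ||| y
  | .xor, x, y => x ^^^ y
  | .shl, x, y => x <<< y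
  | .shr, x, y => x >>> y

/-- A program of the random access machine, in structured form. Numbers in the constructors `op`,
`load`, `store`, `ite`, `loop` are names of registers; a program names only finitely many of them.
Programs with jumps can be brought into this form (one loop that branches on a program counter)
with a slowdown by a constant factor that depends on the program only. -/
inductive Prog where
  /-- do nothing -/
  | skip : Prog
  /-- `const r c`: write the number `c` into register `r` -/
  | const (r c : ℕ) : Prog
  /-- `op o r x y`: write the result of `o` on registers `x`, `y` into register `r` -/
  | op (o : BinOp) (r x y : ℕ) : Prog
  /-- `load r x`: write into register `r` the memory cell whose address is in register `x` -/
  | load (r x : ℕ) : Prog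
  /-- `store x y`: write register `y` into the memory cell whose address is in register `x` -/
  | store (x y : ℕ) : Prog
  /-- first `p`, then `q` -/
  | seq (p q : Prog) : Prog
  /-- `ite r p q`: if register `r` is nonzero then `p`, else `q` -/
  | ite (r : ℕ) (p q : Prog) : Prog
  /-- `loop r p`: while register `r` is nonzero, do `p` -/
  | loop (r : ℕ) (p : Prog) : Prog

/-- A state of the machine: the registers and the memory cells. -/
@[ext]
structure State where
  reg : ℕ → ℕ
  mem : ℕ → ℕ

/-- Overwrite a register. -/
def State.setReg (s : State) (r v : ℕ) : State :=
  { reg := Function.update s.reg r v, mem := s.mem }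

/-- Overwrite a memory cell. -/
def State.setMem (s : State) (i v : ℕ) : State :=
  { reg := s.reg, mem := Function.update s.mem i v }

/-- The state in which the machine starts: the input stands in the memory cells `0, 1, 2, …`,
all other cells and all registers are zero. -/
def State.ofInput (l : List ℕ) : State :=
  { reg := fun _ => 0, mem := fun i => l.getD i 0 }

/-- `Exec W p s t s'`: started in state `s`, the program `p` halts after exactly `t` steps in
state `s'`, and every word it produces on the way is smaller than `W` (a run that would produce a
larger word is not a legal run). Each elementary instruction and each test costs one step. -/
inductive Exec (W : ℕ) : Prog → State → ℕ → State → Prop where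
  | skip (s : State) : Exec W .skip s 1 s
  | const (s : State) (r c : ℕ) (h : c < W) : Exec W (.const r c) s 1 (s.setReg r c)
  | op (s : State) (o : BinOp) (r x y : ℕ) (h : o.eval (s.reg x) (s.reg y) < W) :
      Exec W (.op o r x y) s 1 (s.setReg r (o.eval (s.reg x) (s.reg y)))
  | load (s : State) (r x : ℕ) (h : s.mem (s.reg x) < W) :
      Exec W (.load r x) s 1 (s.setReg r (s.mem (s.reg x)))
  | store (s : State) (x y : ℕ) : Exec W (.store x y) s 1 (s.setMem (s.reg x) (s.reg y))
  | seq {p q : Prog} {s s' s'' : State} {t t' : ℕ}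
      (hp : Exec W p s t s') (hq : Exec W q s' t' s'') : Exec W (.seq p q) s (t + t') s''
  | iteTrue {r : ℕ} {p q : Prog} {s s' : State} {t : ℕ}
      (hr : s.reg r ≠ 0) (hp : Exec W p s t s') : Exec W (.ite r p q) s (t + 1) s'
  | iteFalse {r : ℕ} {p q : Prog} {s s' : State} {t : ℕ}
      (hr : s.reg r = 0) (hq : Exec W q s t s') : Exec W (.ite r p q) s (t + 1) s'
  | loopDone {r : ℕ} {p : Prog} {s : State} (hr : s.reg r = 0) : Exec W (.loop r p) s 1 s
  | loopStep {r : ℕ} {p : Prog} {s s' s'' : State} {t t' : ℕ}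
      (hr : s.reg r ≠ 0) (hp : Exec W p s t s') (hl : Exec W (.loop r p) s' t' s'') :
      Exec W (.loop r p) s (t + t' + 1) s''

/-- A problem with instances `I` (restricted to those in `dom`), size parameter `size`, input
format `input` and correct outputs `correct` is solvable in time `O(size ^ e)` on a word RAM with
words of `O(log size)` bits: one program, whose words stay below `(size + 2) ^ c` for a constant
`c`, halts within `C * size ^ e` steps with a correct output in register `0`.
As usual for asymptotic bounds, this concerns all sufficiently large sizes. -/
def SolvableInTime {I : Type} (dom : I → Prop) (size : I → ℕ) (input : I → List ℕ)
    (correct : I → ℕ → Prop) (e : ℝ) : Prop :=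
  ∃ (P : Prog) (c n₀ : ℕ) (C : ℝ), ∀ x : I, dom x → n₀ ≤ size x →
    ∃ (t : ℕ) (s : State), Exec ((size x + 2) ^ c) P (State.ofInput (input x)) t s ∧
      (t : ℝ) ≤ C * (size x : ℝ) ^ e ∧ correct x (s.reg 0)

/-! ### Orthogonal vectors -/

/-- A list of `n` zero-one vectors of dimension `d`. -/
structure OVInstance where
  n : ℕ
  d : ℕ
  L : Fin n → Fin d → Bool

/-- There are `K` vectors in the list (repetitions allowed) whose coordinatewise product is the
zero vector. -/
def OVInstance.IsYes (K : ℕ) (x : OVInstance) : Prop :=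
  ∃ v : Fin K → Fin x.n, ∀ j : Fin x.d, ∏ i : Fin K, (x.L (v i) j).toNat = 0

/-- The input format: `n`, `d`, and then the vectors one after the other. -/
def OVInstance.input (x : OVInstance) : List ℕ :=
  x.n :: x.d :: (List.ofFn x.L).flatMap fun v => (List.ofFn v).map Bool.toNat

/-- The `K`-OV hypothesis: `K`-OV on `n` vectors of dimension `n ^ o(1)` requires
`n ^ (K - o(1))` time. That is, for no `ε > 0` can it be solved in time `O(n ^ (K - ε))` by an
algorithm that copes with all dimensions up to `n ^ δ`, however small the constant `δ > 0` is. -/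
def OVHypothesis (K : ℕ) : Prop :=
  ∀ ε δ : ℝ, 0 < ε → 0 < δ →
    ¬ SolvableInTime (fun x : OVInstance => (x.d : ℝ) ≤ (x.n : ℝ) ^ δ)
        OVInstance.n OVInstance.input (fun x b => b ≠ 0 ↔ x.IsYes K) ((K : ℝ) - ε)

/-! ### Straight-line programs -/

/-- A straight-line program over the alphabet `{0, …, σ - 1}`. Its symbols are the numbers
`0, 1, …, σ + rules.length - 1` in this order: the terminals `A < σ`, and the nonterminals `σ + j`,
whose right-hand side is the `j`-th rule and consists of preceding symbols. -/
structure SLP (σ : ℕ) where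
  rules : List (List ℕ)
  start : ℕ
  rules_ne_nil : ∀ r ∈ rules, r ≠ []
  ordered : ∀ (j : ℕ) (hj : j < rules.length), ∀ B ∈ rules[j], B < σ + j
  start_lt : start < σ + rules.length

/-- The size: the number of symbols plus the total length of the productions. -/
def SLP.size {σ : ℕ} (G : SLP σ) : ℕ :=
  σ + G.rules.length + (G.rules.map List.length).sum

/-- The right-hand side of a nonterminal. -/
def SLP.rhs {σ : ℕ} (G : SLP σ) (A : ℕ) : List ℕ :=
  G.rules.getD (A - σ) []

/-- The expansion of a symbol. The test `B < A` always succeeds for symbols of the program. -/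
def SLP.exp {σ : ℕ} (G : SLP σ) (A : ℕ) : List ℕ :=
  if A < σ then [A] else (G.rhs A).flatMap fun B => if _h : B < A then G.exp B else []
termination_by A

theorem SLP.exp_terminal {σ : ℕ} (G : SLP σ) {A : ℕ} (hA : A < σ) : G.exp A = [A] := by
  rw [SLP.exp, if_pos hA]

theorem SLP.exp_nonterminal {σ : ℕ} (G : SLP σ) (j : ℕ) (hj : j < G.rules.length) :
    G.exp (σ + j) = (G.rules[j]).flatMap G.exp := by
  have h : G.rhs (σ + j) = G.rules[j] := by simp [SLP.rhs, hj]
  rw [SLP.exp, if_neg (by omega), h]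
  refine List.flatMap_congr fun B hB => ?_
  rw [dif_pos (G.ordered j hj B hB)]

/-- The program represents the string `X`. -/
def SLP.Represents {σ N : ℕ} (G : SLP σ) (X : Fin N → Fin σ) : Prop :=
  G.exp G.start = List.ofFn fun p => (X p : ℕ)

/-- The way a program is written into memory: the number of rules, the start symbol, and then, for
each rule, its length followed by its symbols. -/
def SLP.code {σ : ℕ} (G : SLP σ) : List ℕ :=
  G.rules.length :: G.start :: G.rules.flatMap fun r => r.length :: r

/-! ### Shift distance -/

/-- The offset score of `k` strings of length `N` for the shifts `Δ`: the number of positions at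
which all shifted strings have the same symbol. Addition in `Fin N` is modulo `N`, so that
strings wrap around. -/
def offsetScore {k N σ : ℕ} (X : Fin k → Fin N → Fin σ) (Δ : Fin k → Fin N) : ℕ :=
  (Finset.univ.filter fun p : Fin N => ∀ i j : Fin k, X i (p + Δ i) = X j (p + Δ j)).card

/-- `k`-shift distance: the best offset score, where the last string is not shifted. -/
def shiftDistance {k N σ : ℕ} (X : Fin k → Fin N → Fin σ) : ℕ :=
  (Finset.univ.filter fun Δ : Fin k → Fin N =>
    ∀ i : Fin k, (i : ℕ) + 1 = k → (Δ i : ℕ) = 0).sup (offsetScore X)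

/-- `k` strings of the same length `N` over the alphabet `{0, …, σ - 1}`. -/
structure SDInstance (k σ : ℕ) where
  N : ℕ
  X : Fin k → Fin N → Fin σ

/-- The format for uncompressed input: `N`, and then the strings one after the other. -/
def SDInstance.input {k σ : ℕ} (x : SDInstance k σ) : List ℕ :=
  x.N :: (List.ofFn x.X).flatMap fun Y => List.ofFn fun p => (Y p : ℕ)

/-- A straight-line program for each of the `k` strings. -/
structure CompressedSDInstance (k σ : ℕ) extends SDInstance k σ where
  G : Fin k → SLP σ
  represents : ∀ i, (G i).Represents (X i)

/-- The format for compressed input: `N`, and then the straight-line programs one after the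
other. -/
def CompressedSDInstance.input {k σ : ℕ} (x : CompressedSDInstance k σ) : List ℕ :=
  x.N :: (List.ofFn x.G).flatMap SLP.code

/-- Each of the straight-line programs has size between `N ^ (α - δ)` and `N ^ (α + δ)`. -/
def CompressedSDInstance.SizeNear {k σ : ℕ} (x : CompressedSDInstance k σ) (α δ : ℝ) : Prop :=
  ∀ i, (x.N : ℝ) ^ (α - δ) ≤ ((x.G i).size : ℝ) ∧ ((x.G i).size : ℝ) ≤ (x.N : ℝ) ^ (α + δ)

/-- `k`-shift distance over an alphabet of size `σ`, on strings that have straight-line programs of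
size `N ^ (α ± δ)`, is solvable in time `O(N ^ e)` when the strings themselves are the input. -/
def SolvableFromStrings (k σ : ℕ) (α δ e : ℝ) : Prop :=
  SolvableInTime
    (fun x : SDInstance k σ =>
      ∃ y : CompressedSDInstance k σ, y.toSDInstance = x ∧ y.SizeNear α δ)
    SDInstance.N SDInstance.input (fun x b => b = shiftDistance x.X) e

/-- `k`-shift distance over an alphabet of size `σ`, on strings given by straight-line programs of
size `N ^ (α ± δ)`, is solvable in time `O(N ^ e)` when the straight-line programs are the input. -/
def SolvableFromSLPs (k σ : ℕ) (α δ e : ℝ) : Prop :=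
  SolvableInTime (fun x : CompressedSDInstance k σ => x.SizeNear α δ)
    (fun x => x.N) CompressedSDInstance.input (fun x b => b = shiftDistance x.X) e

end KSD

/-!
Orthogonal vectors reduce to shift distance as follows. An instance has `n` vectors of dimension
`d`, and the `a * (k - 1)` vectors that are sought form `k - 1` tuples of length `a`. A tuple is a
number `t < n ^ a` with digits in base `n`, and it is chosen by shifting one of the strings by
`t`: the strings consist of slots of length `n ^ a`, and position `t` of a slot depends on whether
all vectors of the tuple `t` have a one in some coordinate (`OVInstance.str`). The last string,
which is not shifted, can only match at the beginning of a slot.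

A position matches if *all* strings agree, whereas a coordinate is good if *some* tuple has
product zero there. So each coordinate gets `k - 1` slots, and slot `τ` matches if `τ` is the
first tuple with product zero. At most one of these slots matches, whatever the shifts are
(`OVInstance.div_div_ne_of_lt`), because each type of slot has its own symbol. One further slot,
with a symbol that occurs nowhere else, matches only if all shifts are shorter than a slot, so that
they are tuples (`OVInstance.lt_and_exists_of_le_card`). Hence the distance is at most `d + 1`, and
it is `d + 1` exactly if there are orthogonal vectors
(`OVInstance.lt_shiftDistance_iff`).

The strings have length `N = n ^ (a + o(1))`. A slot is compressed by recursion on the number of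
digits of `t`: a slot for `l + 1` digits is a concatenation of `n` slots for `l` digits, and the
only thing to remember about the leading digits is one bit, the product of their entries. This
gives straight-line programs of size `n ^ (1 + o(1)) = N ^ (1 / a + o(1))`
(`OVInstance.exp_start_slp`, `OVInstance.sizeNear`).

The given algorithm for shift distance may be faster than the time it takes to write down its
input, for instance if `k = 2`. The reduction therefore never writes this input. Each of its words
is a fixed arithmetic expression in the address and the instance of orthogonal vectors, and the
algorithm is simulated on a virtual memory whose initial contents are computed at the time of
access (`Prog.lazy`, `SolvableInTime.of_lazy`), at the cost of a constant factor. That no time is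
needed to initialize the flags of the virtual cells is due to the machine starting with cells that
are zero.
-/

namespace KSD

/-! ### Arithmetic expressions on a word RAM -/

/-- Arithmetic expressions over registers and memory cells. Only operations whose results are
polynomially bounded in their arguments are allowed, so that the values of an expression stay
polynomial in a bound on registers and memory. -/
inductive WordExpr where
  | var (r : ℕ) : WordExpr
  | num (c : ℕ) : WordExpr
  | bin (o : BinOp) (h : ∀ x y, o.eval x y ≤ (x + 1) * (y + 1)) (e f : WordExpr) : WordExpr
  | load (e : WordExpr) : WordExpr
  | cond (c e f : WordExpr) : WordExpr

namespace WordExpr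

/-- The value of an expression, given the registers `ρ` and the memory `μ`. -/
def eval (ρ μ : ℕ → ℕ) : WordExpr → ℕ
  | var r => ρ r
  | num c => c
  | bin o _ e f => o.eval (e.eval ρ μ) (f.eval ρ μ)
  | load e => μ (e.eval ρ μ)
  | cond c e f => if c.eval ρ μ = 0 then f.eval ρ μ else e.eval ρ μ

instance : Add WordExpr := ⟨bin .add fun x y => by simp only [BinOp.eval]; nlinarith⟩
instance : Mul WordExpr := ⟨bin .mul fun x y => by simp only [BinOp.eval]; nlinarith⟩
instance : Sub WordExpr := ⟨bin .sub fun x y =>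
  (Nat.sub_le x y).trans (by nlinarith [Nat.zero_le (x * y)])⟩
instance : Div WordExpr := ⟨bin .div fun x y =>
  (Nat.div_le_self x y).trans (by nlinarith [Nat.zero_le (x * y)])⟩
instance : Mod WordExpr := ⟨bin .mod fun x y =>
  (Nat.mod_le x y).trans (by nlinarith [Nat.zero_le (x * y)])⟩

/-- The expression `if x < y then e else f`. -/
def ifLt (x y e f : WordExpr) : WordExpr := cond (y - x) e f

/-- The expression `if x = y then e else f`. -/
def ifEq (x y e f : WordExpr) : WordExpr := cond ((x - y) + (y - x)) f e

/-- The expression `x ^ l`, for a fixed exponent `l`. -/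
def npow (x : WordExpr) : ℕ → WordExpr
  | 0 => num 1
  | l + 1 => npow x l * x

section eval

variable (ρ μ : ℕ → ℕ) (x y e f : WordExpr)

@[simp] theorem eval_var (r : ℕ) : (var r).eval ρ μ = ρ r := rfl
@[simp] theorem eval_num (c : ℕ) : (num c).eval ρ μ = c := rfl
@[simp] theorem eval_load : (load e).eval ρ μ = μ (e.eval ρ μ) := rfl
@[simp] theorem eval_add : (x + y).eval ρ μ = x.eval ρ μ + y.eval ρ μ := rfl
@[simp] theorem eval_mul : (x * y).eval ρ μ = x.eval ρ μ * y.eval ρ μ := rfl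
@[simp] theorem eval_sub : (x - y).eval ρ μ = x.eval ρ μ - y.eval ρ μ := rfl
@[simp] theorem eval_div : (x / y).eval ρ μ = x.eval ρ μ / y.eval ρ μ := rfl
@[simp] theorem eval_mod : (x % y).eval ρ μ = x.eval ρ μ % y.eval ρ μ := rfl

@[simp] theorem eval_cond : (cond x e f).eval ρ μ =
    if x.eval ρ μ = 0 then f.eval ρ μ else e.eval ρ μ := rfl

@[simp] theorem eval_ifLt : (ifLt x y e f).eval ρ μ =
    if x.eval ρ μ < y.eval ρ μ then e.eval ρ μ else f.eval ρ μ := by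
  by_cases h : x.eval ρ μ < y.eval ρ μ
  · have h' : (y - x).eval ρ μ ≠ 0 := by rw [eval_sub]; omega
    rw [if_pos h]
    exact if_neg h'
  · have h' : (y - x).eval ρ μ = 0 := by rw [eval_sub]; omega
    rw [if_neg h]
    exact if_pos h'

@[simp] theorem eval_ifEq : (ifEq x y e f).eval ρ μ =
    if x.eval ρ μ = y.eval ρ μ then e.eval ρ μ else f.eval ρ μ := by
  by_cases h : x.eval ρ μ = y.eval ρ μ
  · have h' : ((x - y) + (y - x)).eval ρ μ = 0 := by
      rw [eval_add, eval_sub, eval_sub]; omega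
    rw [if_pos h]
    exact if_pos h'
  · have h' : ((x - y) + (y - x)).eval ρ μ ≠ 0 := by
      rw [eval_add, eval_sub, eval_sub]; omega
    rw [if_neg h]
    exact if_neg h'

@[simp] theorem eval_npow (l : ℕ) : (npow x l).eval ρ μ = x.eval ρ μ ^ l := by
  induction l with
  | zero => rfl
  | succ l ih => simp [npow, ih, pow_succ]

end eval

/-- An exponent that bounds the values of an expression and of its subexpressions
(see `eval_lt`). -/
def deg : WordExpr → ℕ
  | var _ => 1
  | num c => c + 1
  | bin _ _ e f => e.deg + f.deg + 1
  | load e => e.deg + 1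
  | cond c e f => c.deg + e.deg + f.deg

/-- The program that writes the value of an expression into register `2 * i + 1`. The variables of
the expression are kept in the registers of even number, and intermediate results in those of odd
number above `2 * i`. -/
def compile : WordExpr → ℕ → Prog
  | var r, i => .seq (.const (2 * i + 1) 0) (.op .add (2 * i + 1) (2 * r) (2 * i + 1))
  | num c, i => .const (2 * i + 1) c
  | bin o _ e f, i => .seq (e.compile i)
      (.seq (f.compile (i + 1)) (.op o (2 * i + 1) (2 * i + 1) (2 * (i + 1) + 1)))
  | load e, i => .seq (e.compile i) (.load (2 * i + 1) (2 * i + 1))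
  | cond c e f, i => .seq (c.compile i) (.ite (2 * i + 1) (e.compile i) (f.compile i))

/-- A bound on the running time of `compile`. -/
def cost : WordExpr → ℕ
  | var _ => 2
  | num _ => 1
  | bin _ _ e f => e.cost + f.cost + 1
  | load e => e.cost + 1
  | cond c e f => c.cost + e.cost + f.cost + 1

theorem eval_lt {V : ℕ} (hV : 2 ≤ V) {ρ μ : ℕ → ℕ} (hρ : ∀ r, ρ r < V) (hμ : ∀ i, μ i < V)
    (e : WordExpr) : e.eval ρ μ < V ^ e.deg := by
  have hpos : ∀ m, 0 < V ^ m := fun m => Nat.pow_pos (by omega)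
  have hmono : ∀ {m m'}, m ≤ m' → V ^ m ≤ V ^ m' := Nat.pow_le_pow_right (by omega)
  induction e with
  | var r => simpa [deg] using hρ r
  | num c =>
    exact (Nat.lt_pow_self (by omega : 1 < V)).trans_le (hmono (Nat.le_succ c))
  | bin o h e f ihe ihf =>
    calc o.eval (e.eval ρ μ) (f.eval ρ μ) ≤ (e.eval ρ μ + 1) * (f.eval ρ μ + 1) := h _ _
      _ ≤ V ^ e.deg * V ^ f.deg := Nat.mul_le_mul ihe ihf
      _ = V ^ (e.deg + f.deg) := (pow_add _ _ _).symm
      _ < V ^ (e.deg + f.deg + 1) := Nat.pow_lt_pow_right (by omega) (Nat.lt_succ_self _)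
  | load e ih =>
    exact (hμ _).trans_le ((pow_one V).symm.le.trans (hmono (Nat.le_add_left _ _)))
  | cond c e f _ ihe ihf =>
    simp only [eval_cond, deg]
    split_ifs
    · exact ihf.trans_le (hmono (Nat.le_add_left _ _))
    · exact ihe.trans_le (hmono (by omega))

theorem exec_compile {V W : ℕ} (hV : 2 ≤ V) (e : WordExpr) (i : ℕ) (s : State)
    (hρ : ∀ r, s.reg (2 * r) < V) (hμ : ∀ i, s.mem i < V) (hW : V ^ e.deg ≤ W) :
    ∃ (t : ℕ) (s' : State), Exec W (e.compile i) s t s' ∧ t ≤ e.cost ∧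
      s'.reg (2 * i + 1) = e.eval (fun r => s.reg (2 * r)) s.mem ∧ s'.mem = s.mem ∧
      (∀ r, s'.reg (2 * r) = s.reg (2 * r)) ∧ ∀ j < i, s'.reg (2 * j + 1) = s.reg (2 * j + 1) := by
  have hmono : ∀ {m m'}, m ≤ m' → V ^ m ≤ V ^ m' := Nat.pow_le_pow_right (by omega)
  have hlt := eval_lt hV (ρ := fun r => s.reg (2 * r)) hρ hμ e
  induction e generalizing i s with
  | var r =>
    have h0 : 0 < W := (Nat.pow_pos (by omega)).trans_le hW
    refine ⟨_, _, .seq (.const _ _ 0 h0) (.op _ .add _ _ _ ?_), le_rfl, ?_, rfl, ?_, ?_⟩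
    · have : s.reg (2 * r) < W := hlt.trans_le hW
      simpa [BinOp.eval, State.setReg, Function.update_apply,
        show 2 * r ≠ 2 * i + 1 by omega] using this
    · simp [BinOp.eval, State.setReg, show 2 * r ≠ 2 * i + 1 by omega]
    · intro j
      simp [State.setReg, show 2 * j ≠ 2 * i + 1 by omega]
    · intro j hj
      simp [State.setReg, show j ≠ i by omega]
  | num c =>
    refine ⟨_, _, .const _ _ c (hlt.trans_le hW), le_rfl, ?_, rfl, ?_, ?_⟩
    · simp [State.setReg]
    · intro j
      simp [State.setReg, show 2 * j ≠ 2 * i + 1 by omega]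
    · intro j hj
      simp [State.setReg, show j ≠ i by omega]
  | bin o h e f ihe ihf =>
    obtain ⟨t₁, s₁, h₁, ht₁, hv₁, hm₁, hr₁, hj₁⟩ := ihe i s hρ hμ
      ((hmono (by simp only [deg]; omega)).trans hW) (eval_lt hV hρ hμ e)
    obtain ⟨t₂, s₂, h₂, ht₂, hv₂, hm₂, hr₂, hj₂⟩ := ihf (i + 1) s₁
      (fun r => by rw [hr₁]; exact hρ r) (fun r => by rw [hm₁]; exact hμ r)
      ((hmono (by simp only [deg]; omega)).trans hW)
      (eval_lt hV (fun r => by rw [hr₁]; exact hρ r) (fun r => by rw [hm₁]; exact hμ r) f)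
    have e₁ : s₂.reg (2 * i + 1) = e.eval (fun r => s.reg (2 * r)) s.mem := by
      rw [hj₂ i (Nat.lt_succ_self i), hv₁]
    have e₂ : s₂.reg (2 * (i + 1) + 1) = f.eval (fun r => s.reg (2 * r)) s.mem := by
      rw [hv₂, hm₁]; simp only [hr₁]
    refine ⟨_, _, .seq h₁ (.seq h₂ (.op _ o _ _ _ ?_)), ?_, ?_, ?_, ?_, ?_⟩
    · rw [e₁, e₂]; exact hlt.trans_le hW
    · simp only [cost]; omega
    · rw [e₁, e₂]; simp [State.setReg, eval]
    · simp [State.setReg, hm₁, hm₂]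
    · intro j
      simp [State.setReg, show 2 * j ≠ 2 * i + 1 by omega, hr₁, hr₂]
    · intro j hj
      simp [State.setReg, show j ≠ i by omega, hj₁ j hj,
        hj₂ j (by omega)]
  | load e ih =>
    obtain ⟨t₁, s₁, h₁, ht₁, hv₁, hm₁, hr₁, hj₁⟩ := ih i s hρ hμ
      ((hmono (by simp only [deg]; omega)).trans hW) (eval_lt hV hρ hμ e)
    refine ⟨_, _, .seq h₁ (.load _ _ _ ?_), ?_, ?_, ?_, ?_, ?_⟩
    · rw [hv₁, hm₁]; exact hlt.trans_le hW
    · simp only [cost]; omega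
    · rw [hv₁, hm₁]; simp [State.setReg]
    · simp [State.setReg, hm₁]
    · intro j
      simp [State.setReg, show 2 * j ≠ 2 * i + 1 by omega, hr₁]
    · intro j hj
      simp [State.setReg, show j ≠ i by omega, hj₁ j hj]
  | cond c e f ihc ihe ihf =>
    obtain ⟨t₁, s₁, h₁, ht₁, hv₁, hm₁, hr₁, hj₁⟩ := ihc i s hρ hμ
      ((hmono (by simp only [deg]; omega)).trans hW) (eval_lt hV hρ hμ c)
    have hρ₁ : ∀ r, s₁.reg (2 * r) < V := fun r => by rw [hr₁]; exact hρ r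
    have hμ₁ : ∀ r, s₁.mem r < V := fun r => by rw [hm₁]; exact hμ r
    by_cases hc : c.eval (fun r => s.reg (2 * r)) s.mem = 0
    · obtain ⟨t₂, s₂, h₂, ht₂, hv₂, hm₂, hr₂, hj₂⟩ := ihf i s₁ hρ₁ hμ₁
        ((hmono (by simp only [deg]; omega)).trans hW) (eval_lt hV hρ₁ hμ₁ f)
      refine ⟨_, _, .seq h₁ (.iteFalse (hv₁.trans hc) h₂), ?_, ?_, hm₂.trans hm₁, ?_, ?_⟩
      · simp only [cost]; omega
      · rw [hv₂, hm₁]; simp [hr₁, hc]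
      · intro j; rw [hr₂, hr₁]
      · intro j hj; rw [hj₂ j hj, hj₁ j hj]
    · obtain ⟨t₂, s₂, h₂, ht₂, hv₂, hm₂, hr₂, hj₂⟩ := ihe i s₁ hρ₁ hμ₁
        ((hmono (by simp only [deg]; omega)).trans hW) (eval_lt hV hρ₁ hμ₁ e)
      refine ⟨_, _, .seq h₁ (.iteTrue (by rwa [hv₁]) h₂), ?_, ?_, hm₂.trans hm₁, ?_, ?_⟩
      · simp only [cost]; omega
      · rw [hv₂, hm₁]; simp [hr₁, hc]
      · intro j; rw [hr₂, hr₁]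
      · intro j hj; rw [hj₂ j hj, hj₁ j hj]

/-- The program that writes the value of an expression into the even register `2 * r`. -/
def assign (r : ℕ) (e : WordExpr) : Prog :=
  .seq (e.compile 0) (.seq (.const 3 0) (.op .add (2 * r) 1 3))

theorem exec_assign {V W : ℕ} (hV : 2 ≤ V) (r : ℕ) (e : WordExpr) (s : State)
    (hρ : ∀ r, s.reg (2 * r) < V) (hμ : ∀ i, s.mem i < V) (hW : V ^ e.deg ≤ W) :
    ∃ (t : ℕ) (s' : State), Exec W (assign r e) s t s' ∧ t ≤ e.cost + 2 ∧ s'.mem = s.mem ∧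
      ∀ q, s'.reg (2 * q) =
        Function.update (fun q => s.reg (2 * q)) r (e.eval (fun q => s.reg (2 * q)) s.mem) q := by
  obtain ⟨t, s₁, h, ht, hv, hm, hr, -⟩ := exec_compile hV e 0 s hρ hμ hW
  have hlt := (eval_lt hV hρ hμ e).trans_le hW
  refine ⟨_, _, .seq h (.seq (.const _ 3 0 (by omega)) (.op _ .add _ _ _ ?_)), by omega, ?_, ?_⟩
  · simpa [BinOp.eval, State.setReg, Function.update_apply, hv] using hlt
  · simp [State.setReg, hm]
  · intro q
    by_cases hq : q = r
    · simp [BinOp.eval, State.setReg, hv, hq]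
    · simp [State.setReg, hq, hr, show 2 * q ≠ 3 by omega]

end WordExpr

/-! ### Simulation with lazily initialized memory -/

/-- The address of the first of the two cells that represent the virtual cell whose address is in
register `x`, when the representation starts behind the first `b` cells. -/
def lazyCell (b : WordExpr) (x : ℕ) : WordExpr := b + .num 2 * .var x

/-- The contents of the virtual cell whose address is in register `x`: the first of its two cells
tells whether it has been written, and if not, its contents are those computed by `Q`. -/
def lazyLoad (b : WordExpr) (Q : WordExpr → WordExpr) (x : ℕ) : WordExpr :=
  .cond (.load (lazyCell b x)) (.load (lazyCell b x + .num 1)) (Q (.var x))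

/-- Replace each memory access of a program by an access to a virtual memory whose initial contents
are computed on demand. The virtual register `r` is kept in register `2 * r`. The virtual cell with
address `A` is represented by two cells behind the first `b` ones, namely `b + 2 * A`, which tells
whether the cell has been written, and `b + 2 * A + 1`, which then holds its contents; a cell that
has not been written contains the value of `Q A`. -/
def Prog.lazy (b : WordExpr) (Q : WordExpr → WordExpr) : Prog → Prog
  | .skip => .skip
  | .const r c => .const (2 * r) c
  | .op o r x y => .op o (2 * r) (2 * x) (2 * y)
  | .load r x => WordExpr.assign r (lazyLoad b Q x)
  | .store x y => .seq ((lazyCell b x).compile 0) (.seq (.const 3 1) (.seq (.store 1 3)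
      (.seq (.const 3 1) (.seq (.op .add 1 1 3) (.store 1 (2 * y))))))
  | .seq p q => .seq (p.lazy b Q) (q.lazy b Q)
  | .ite r p q => .ite (2 * r) (p.lazy b Q) (q.lazy b Q)
  | .loop r p => .loop (2 * r) (p.lazy b Q)

/-- The factor by which `Prog.lazy` slows a program down. -/
def Prog.lazyCost (b : WordExpr) (Q : WordExpr → WordExpr) : Prog → ℕ
  | .skip => 1
  | .const _ _ => 1
  | .op _ _ _ _ => 1
  | .load _ x => (lazyLoad b Q x).cost + 2
  | .store x _ => (lazyCell b x).cost + 5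
  | .seq p q => p.lazyCost b Q + q.lazyCost b Q
  | .ite _ p q => p.lazyCost b Q + q.lazyCost b Q + 1
  | .loop _ p => p.lazyCost b Q + 1

/-- The words of `Prog.lazy` stay below this power of a bound on the simulated words. -/
def Prog.lazyDeg (b : WordExpr) (Q : WordExpr → WordExpr) : Prog → ℕ
  | .skip => 1
  | .const _ _ => 1
  | .op _ _ _ _ => 1
  | .load _ x => (lazyLoad b Q x).deg + 1
  | .store x _ => (lazyCell b x).deg + 1
  | .seq p q => p.lazyDeg b Q + q.lazyDeg b Q
  | .ite _ p q => p.lazyDeg b Q + q.lazyDeg b Q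
  | .loop _ p => p.lazyDeg b Q

theorem Prog.one_le_lazyDeg (b : WordExpr) (Q : WordExpr → WordExpr) (P : Prog) :
    1 ≤ P.lazyDeg b Q := by
  induction P <;> simp only [lazyDeg] <;> omega

/-- The state `p` represents the virtual state `s` in the sense of `Prog.lazy`, for a virtual memory
that has been initialized with `init`, while the words of both stay below `V`. The list `l` is the
real input, which remains unchanged at the beginning of the real memory. -/
structure Represents (V : ℕ) (l : List ℕ) (init : ℕ → ℕ) (s p : State) : Prop where
  reg : ∀ r, p.reg (2 * r) = s.reg r
  reg_lt : ∀ r, p.reg (2 * r) < V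
  mem_lt : ∀ i, p.mem i < V
  input : ∀ i < l.length, p.mem i = l.getD i 0
  mem : ∀ A, (p.mem (l.length + 2 * A) = 0 ∧ s.mem A = init A) ∨
    (p.mem (l.length + 2 * A) ≠ 0 ∧ s.mem A = p.mem (l.length + 2 * A + 1))

theorem Represents.setReg {V : ℕ} {l : List ℕ} {init : ℕ → ℕ} {s p p' : State}
    (h : Represents V l init s p) {r v : ℕ} (hv : v < V) (hm : p'.mem = p.mem)
    (hr : ∀ q, p'.reg (2 * q) = Function.update (fun q => p.reg (2 * q)) r v q) :
    Represents V l init (s.setReg r v) p' where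
  reg q := by
    rw [hr]
    by_cases hq : q = r <;> simp [State.setReg, hq, h.reg]
  reg_lt q := by
    rw [hr]
    by_cases hq : q = r
    · simpa [hq] using hv
    · simpa [hq] using h.reg_lt q
  mem_lt i := by rw [hm]; exact h.mem_lt i
  input i hi := by rw [hm]; exact h.input i hi
  mem A := by rw [hm]; exact h.mem A

/-- The lazy version of a program simulates it step by step. The assumptions say that the expression
`b` gives the length of the real input `l`, and that `Q` computes the initial virtual memory
from `l`. -/
theorem exec_lazy {V W W' : ℕ} {l : List ℕ} {init : ℕ → ℕ} {b : WordExpr}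
    {Q : WordExpr → WordExpr} (hV : 2 ≤ V) (hW : W ≤ V)
    (hb : ∀ ρ μ, (∀ i < l.length, μ i = l.getD i 0) → b.eval ρ μ = l.length)
    (hQ : ∀ ρ μ, (∀ i < l.length, μ i = l.getD i 0) →
      ∀ e, (Q e).eval ρ μ = init (e.eval ρ μ))
    {P : Prog} {s s' : State} {t : ℕ} (h : Exec W P s t s') (hW' : V ^ P.lazyDeg b Q ≤ W')
    {p : State} (hp : Represents V l init s p) :
    ∃ (t' : ℕ) (p' : State), Exec W' (P.lazy b Q) p t' p' ∧ t' ≤ P.lazyCost b Q * t ∧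
      Represents V l init s' p' := by
  have hmono : ∀ {m m'}, m ≤ m' → V ^ m ≤ V ^ m' := Nat.pow_le_pow_right (by omega)
  have hVW : V ≤ W' := by
    refine le_trans ?_ hW'
    simpa using hmono (Prog.one_le_lazyDeg b Q P)
  induction h generalizing p with
  | skip s => exact ⟨_, _, .skip _, le_rfl, hp⟩
  | const s r c h =>
    refine ⟨_, _, .const _ _ c (by omega), le_rfl, hp.setReg (by omega) rfl fun q => ?_⟩
    by_cases hq : q = r <;> simp [State.setReg, hq]
  | op s o r x y h =>
    have h' : o.eval (p.reg (2 * x)) (p.reg (2 * y)) = o.eval (s.reg x) (s.reg y) := by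
      rw [hp.reg, hp.reg]
    refine ⟨_, _, .op _ o _ _ _ (by omega), le_rfl, hp.setReg (by omega) rfl fun q => ?_⟩
    by_cases hq : q = r <;> simp [State.setReg, hq, h']
  | load s r x h =>
    obtain ⟨t', p', he, ht, hm, hr⟩ := WordExpr.exec_assign hV r (lazyLoad b Q x) p hp.reg_lt
      hp.mem_lt ((hmono (Nat.le_succ _)).trans hW')
    refine ⟨t', p', he, by simpa [Prog.lazyCost] using ht, hp.setReg (by omega) hm fun q => ?_⟩
    rw [hr]
    congr 1
    have hbx : (lazyCell b x).eval (fun q => p.reg (2 * q)) p.mem = l.length + 2 * s.reg x := by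
      simp [lazyCell, hb _ _ hp.input, hp.reg]
    rcases hp.mem (s.reg x) with ⟨h0, h1⟩ | ⟨h0, h1⟩
    · refine Eq.trans (if_pos ?_) ?_
      · rw [WordExpr.eval_load, hbx, h0]
      · rw [hQ _ _ hp.input, WordExpr.eval_var, hp.reg, h1]
    · refine Eq.trans (if_neg ?_) ?_
      · rwa [WordExpr.eval_load, hbx]
      · rw [WordExpr.eval_load, WordExpr.eval_add, hbx, WordExpr.eval_num, h1]
  | store s x y =>
    have hd : V ^ (lazyCell b x).deg * V ≤ W' := by
      rw [← pow_succ]; exact hW'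
    have hd' : V ^ (lazyCell b x).deg ≤ W' :=
      (hmono (Nat.le_succ _)).trans hW'
    obtain ⟨t', p', he, ht, hv, hm, hr, -⟩ := WordExpr.exec_compile hV (lazyCell b x) 0 p
      hp.reg_lt hp.mem_lt hd'
    have hlt := WordExpr.eval_lt hV (ρ := fun q => p.reg (2 * q)) hp.reg_lt hp.mem_lt
      (lazyCell b x)
    have hbx : (lazyCell b x).eval (fun q => p.reg (2 * q)) p.mem =
        l.length + 2 * s.reg x := by
      simp [lazyCell, hb _ _ hp.input, hp.reg]
    rw [hbx] at hlt hv
    have h1 : 1 < W' := by omega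
    have hlt' : l.length + 2 * s.reg x + 1 < W' := by nlinarith
    refine ⟨_, _, .seq he (.seq (.const _ 3 1 h1) (.seq (.store _ 1 3) (.seq (.const _ 3 1 h1)
      (.seq (.op _ .add 1 1 3 ?_) (.store _ 1 (2 * y)))))), ?_, ?_⟩
    · simpa [State.setReg, State.setMem, BinOp.eval, hv] using hlt'
    · simp only [Prog.lazyCost]; omega
    · have hy := hp.reg_lt y
      rw [hp.reg] at hy
      refine ⟨fun q => ?_, fun q => ?_, fun i => ?_, fun i hi => ?_, fun A => ?_⟩
      · simp [State.setReg, State.setMem, show 2 * q ≠ 1 by omega, show 2 * q ≠ 3 by omega, hr,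
          hp.reg]
      · simp [State.setReg, State.setMem, show 2 * q ≠ 1 by omega, show 2 * q ≠ 3 by omega, hr,
          hp.reg_lt]
      · simp only [State.setReg, State.setMem, BinOp.eval, Function.update_apply, hm]
        have := hp.mem_lt i
        have := hp.reg_lt y
        split_ifs <;> simp_all <;> omega
      · have := hp.input i hi
        simp [State.setReg, State.setMem, BinOp.eval, Function.update_apply, hm, hv, this,
          show i ≠ l.length + 2 * s.reg x by omega,
          show i ≠ l.length + 2 * s.reg x + 1 by omega]
      · by_cases hA : A = s.reg x
        · right
          simp [State.setReg, State.setMem, BinOp.eval, hv, hA, hr,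
            hp.reg, show 2 * y ≠ 1 by omega, show 2 * y ≠ 3 by omega]
        · have := hp.mem A
          simpa [State.setReg, State.setMem, BinOp.eval, Function.update_apply, hv, hA, hm,
            show l.length + 2 * A ≠ l.length + 2 * s.reg x + 1 by omega,
            show l.length + 2 * A + 1 ≠ l.length + 2 * s.reg x by omega] using this
  | seq _ _ ih₁ ih₂ =>
    obtain ⟨t₁, p₁, h₁, ht₁, hp₁⟩ := ih₁ ((hmono (by simp only [Prog.lazyDeg]; omega)).trans hW') hp
    obtain ⟨t₂, p₂, h₂, ht₂, hp₂⟩ :=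
      ih₂ ((hmono (by simp only [Prog.lazyDeg]; omega)).trans hW') hp₁
    refine ⟨_, p₂, .seq h₁ h₂, ?_, hp₂⟩
    simp only [Prog.lazyCost]; nlinarith
  | iteTrue hr _ ih =>
    obtain ⟨t₁, p₁, h₁, ht₁, hp₁⟩ := ih ((hmono (by simp only [Prog.lazyDeg]; omega)).trans hW') hp
    refine ⟨_, p₁, .iteTrue (by rwa [hp.reg]) h₁, ?_, hp₁⟩
    simp only [Prog.lazyCost]; nlinarith
  | iteFalse hr _ ih =>
    obtain ⟨t₁, p₁, h₁, ht₁, hp₁⟩ := ih ((hmono (by simp only [Prog.lazyDeg]; omega)).trans hW') hp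
    refine ⟨_, p₁, .iteFalse (by rwa [hp.reg]) h₁, ?_, hp₁⟩
    simp only [Prog.lazyCost]; nlinarith
  | loopDone hr =>
    exact ⟨_, p, .loopDone (by rwa [hp.reg]), by simp only [Prog.lazyCost]; omega, hp⟩
  | loopStep hr _ _ ih₁ ih₂ =>
    obtain ⟨t₁, p₁, h₁, ht₁, hp₁⟩ := ih₁ hW' hp
    obtain ⟨t₂, p₂, h₂, ht₂, hp₂⟩ := ih₂ hW' hp₁
    refine ⟨_, p₂, .loopStep (by rwa [hp.reg]) h₁ h₂, ?_, hp₂⟩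
    simp only [Prog.lazyCost] at ht₂ ⊢; nlinarith

/-- A reduction in which the instance `y` is never written down: it suffices that each single word
of its input is the value of a fixed expression in the address and the input of `x`. Such a
reduction costs only a constant factor, even for algorithms that do not read their whole input. -/
theorem SolvableInTime.of_lazy {I J : Type} {dom : I → Prop} {size : I → ℕ} {input : I → List ℕ}
    {correct : I → ℕ → Prop} {dom' : J → Prop} {size' : J → ℕ} {input' : J → List ℕ}
    {correct' : J → ℕ → Prop} {e e' : ℝ} (h : SolvableInTime dom' size' input' correct' e')
    (b : WordExpr) (Q : WordExpr → WordExpr) (out : WordExpr) (E n₁ : ℕ) (C₁ : ℝ)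
    (he : 0 ≤ e) (hn₁ : 1 ≤ n₁)
    (hb : ∀ x, ∀ ρ μ, (∀ i < (input x).length, μ i = (input x).getD i 0) →
      b.eval ρ μ = (input x).length)
    (hinput : ∀ x, dom x → n₁ ≤ size x → ∀ i, (input x).getD i 0 < (size x + 2) ^ E)
    (hred : ∀ x, dom x → n₁ ≤ size x → ∃ y, dom' y ∧ size x ≤ size' y ∧
      size' y + 2 ≤ (size x + 2) ^ E ∧ (size' y : ℝ) ^ e' ≤ C₁ * (size x : ℝ) ^ e ∧
      ∀ ρ μ, (∀ i < (input x).length, μ i = (input x).getD i 0) →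
        (∀ e, (Q e).eval ρ μ = (input' y).getD (e.eval ρ μ) 0) ∧
        (correct' y (ρ 0) → correct x (out.eval ρ μ))) :
    SolvableInTime dom size input correct e := by
  obtain ⟨P, c, n₀, C, hP⟩ := h
  refine ⟨.seq (P.lazy b Q) (WordExpr.assign 0 out), (E * c + E + 1) * (P.lazyDeg b Q + out.deg),
    max n₀ n₁, P.lazyCost b Q * (|C| * C₁) + (out.cost + 2 : ℕ), fun x hx hn => ?_⟩
  have hn₁' : n₁ ≤ size x := (le_max_right _ _).trans hn
  obtain ⟨y, hdom, hsize, hsize', htime, hQ⟩ := hred x hx hn₁'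
  obtain ⟨t, s, hexec, ht, hs⟩ := hP y hdom (((le_max_left _ _).trans hn).trans hsize)
  set V := (size x + 2) ^ (E * c + E + 1) with hVdef
  have hmono : ∀ {m m'}, m ≤ m' → (size x + 2) ^ m ≤ (size x + 2) ^ m' :=
    Nat.pow_le_pow_right (by omega)
  have hV : 2 ≤ V := by
    have : (size x + 2) ^ 1 ≤ V := hmono (by omega)
    rw [pow_one] at this
    omega
  have hWV : (size' y + 2) ^ c ≤ V :=
    calc _ ≤ ((size x + 2) ^ E) ^ c := Nat.pow_le_pow_left hsize' c
      _ = (size x + 2) ^ (E * c) := (pow_mul _ _ _).symm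
      _ ≤ V := hmono (by omega)
  have hinV : ∀ i, (input x).getD i 0 < V := fun i =>
    (hinput x hx hn₁' i).trans_le (hmono (by omega))
  have hp : Represents V (input x) (fun A => (input' y).getD A 0)
      (State.ofInput (input' y)) (State.ofInput (input x)) := by
    refine ⟨fun _ => rfl, fun _ => by simp only [State.ofInput]; omega, hinV, fun _ _ => rfl,
      fun A => .inl ⟨?_, rfl⟩⟩
    simp [State.ofInput]
  have hVd : ∀ {m}, m ≤ P.lazyDeg b Q + out.deg →
      V ^ m ≤ (size x + 2) ^ ((E * c + E + 1) * (P.lazyDeg b Q + out.deg)) := fun hm => by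
    rw [pow_mul]
    exact Nat.pow_le_pow_right (by omega) hm
  obtain ⟨t₁, p₁, h₁, ht₁, hp₁⟩ := exec_lazy hV hWV (hb x) (fun ρ μ h => (hQ ρ μ h).1) hexec
    (hVd (Nat.le_add_right _ _)) hp
  obtain ⟨t₂, p₂, h₂, ht₂, -, hr₂⟩ := WordExpr.exec_assign hV 0 out p₁ hp₁.reg_lt hp₁.mem_lt
    (hVd (Nat.le_add_left _ _))
  refine ⟨_, p₂, .seq h₁ h₂, ?_, ?_⟩
  · have hpos : (1 : ℝ) ≤ (size x : ℝ) ^ e :=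
      Real.one_le_rpow (by exact_mod_cast hn₁.trans hn₁') he
    have hT : (t : ℝ) ≤ |C| * (C₁ * (size x : ℝ) ^ e) :=
      calc (t : ℝ) ≤ C * (size' y : ℝ) ^ e' := ht
        _ ≤ |C| * (size' y : ℝ) ^ e' :=
          mul_le_mul_of_nonneg_right (le_abs_self C) (by positivity)
        _ ≤ _ := mul_le_mul_of_nonneg_left htime (abs_nonneg C)
    have h1 : (t₁ : ℝ) ≤ P.lazyCost b Q * t := by exact_mod_cast ht₁
    have h2 : (t₂ : ℝ) ≤ (out.cost + 2 : ℕ) := by exact_mod_cast ht₂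
    have h3 := mul_le_mul_of_nonneg_left hT (Nat.cast_nonneg (α := ℝ) (P.lazyCost b Q))
    have h4 := mul_le_mul_of_nonneg_left hpos (Nat.cast_nonneg (α := ℝ) (out.cost + 2))
    rw [Nat.cast_add]
    linarith
  · have h0 : p₂.reg 0 = out.eval (fun q => p₁.reg (2 * q)) p₁.mem := by
      simpa using hr₂ 0
    rw [h0]
    refine (hQ _ _ hp₁.input).2 ?_
    have := hp₁.reg 0
    simp only [Nat.mul_zero] at this ⊢
    rwa [this]

/-! ### Products over the digits of a number -/

/-- The product of `B v` over the `l` digits `v` of `t` in base `n`. -/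
def digitProd (B : ℕ → ℕ) (n : ℕ) : ℕ → ℕ → ℕ
  | 0, _ => 1
  | l + 1, t => B (t / n ^ l) * digitProd B n l (t % n ^ l)

theorem exists_digitProd_eq_prod {n : ℕ} (l : ℕ) (w : Fin l → Fin n) :
    ∃ t < n ^ l, ∀ B, digitProd B n l t = ∏ i, B (w i) := by
  induction l with
  | zero => exact ⟨0, by simp, fun B => by simp [digitProd]⟩
  | succ l ih =>
    obtain ⟨t, ht, h⟩ := ih fun i => w i.castSucc
    have hw := (w (Fin.last l)).isLt
    refine ⟨t + n ^ l * w (Fin.last l), ?_, fun B => ?_⟩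
    · rw [pow_succ]
      nlinarith [Nat.mul_le_mul_left (n ^ l) hw]
    · rw [digitProd, Nat.add_mul_mod_self_left, Nat.mod_eq_of_lt ht,
        Nat.add_mul_div_left _ _ (by omega), Nat.div_eq_of_lt ht, Nat.zero_add, h,
        Fin.prod_univ_castSucc, mul_comm]

theorem exists_digits {n : ℕ} (l t : ℕ) (ht : t < n ^ l) :
    ∃ w : Fin l → Fin n, ∀ B, digitProd B n l t = ∏ i, B (w i) := by
  induction l generalizing t with
  | zero => exact ⟨Fin.elim0, fun B => by simp [digitProd]⟩
  | succ l ih =>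
    rw [pow_succ] at ht
    have hpos : 0 < n ^ l := Nat.pos_of_ne_zero fun h => by simp [h] at ht
    obtain ⟨w, hw⟩ := ih (t % n ^ l) (Nat.mod_lt _ hpos)
    refine ⟨Fin.snoc (α := fun _ => Fin n) w
      ⟨t / n ^ l, by rw [Nat.div_lt_iff_lt_mul hpos, mul_comm]; exact ht⟩, fun B => ?_⟩
    rw [digitProd, hw, Fin.prod_univ_castSucc, mul_comm]
    simp

theorem digitProd_indicator_zero {n : ℕ} (l t : ℕ) (ht : t < n ^ l) :
    digitProd (fun v => if v = 0 then 1 else 0) n l t = if t = 0 then 1 else 0 := by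
  induction l generalizing t with
  | zero =>
    have : t = 0 := by simpa using ht
    simp [this, digitProd]
  | succ l ih =>
    rw [pow_succ] at ht
    have hpos : 0 < n ^ l := Nat.pos_of_ne_zero fun h => by simp [h] at ht
    rw [digitProd, ih _ (Nat.mod_lt _ hpos)]
    by_cases h : t = 0
    · simp [h]
    · by_cases h' : t / n ^ l = 0
      · have : t % n ^ l ≠ 0 := by
          rwa [Nat.mod_eq_of_lt ((Nat.div_eq_zero_iff_lt hpos).mp h')]
        simp [h, this]
      · simp only [h, h', if_false, zero_mul]

/-! ### The strings of the reduction -/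

namespace OVInstance

/-- Coordinate `j` of the vector `v`, in the form in which it is read from the input. For arguments
out of range this is some other bit of the input, or zero. -/
def bit (x : OVInstance) (v j : ℕ) : ℕ := x.input.getD (2 + (v * x.d + j)) 0

/-- The number of slots of the strings: `k - 1` for each coordinate, and one for
synchronization. -/
def slots (k : ℕ) (x : OVInstance) : ℕ := x.d * (k - 1) + 1

/-- The bit which the digit `v` contributes in slot `s` of string `i`. For the last string, the
product of these bits over all digits of `t` tells whether `t = 0`. -/
def entry (k : ℕ) (x : OVInstance) (i v s : ℕ) : ℕ :=
  if i + 1 = k then (if v = 0 then 1 else 0) else x.bit v (s / (k - 1))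

/-- The symbol in slot `s` of string `i` at a position for which the product of the bits is `b`. The
symbol of a slot is `k - 1` for the last slot and otherwise its type `τ = s % (k - 1)`. The last
string has it where `b` is nonzero. String `i` has the symbol `τ` if its bit `b` is compatible with
`τ` being the number of the first string whose bit is zero: `b ≠ 0` for `i < τ`, and `b = 0` for
`i = τ`. The other positions are filled with `k`, respectively `k + 1` in the last string, and never
match. -/
def symb (k : ℕ) (x : OVInstance) (i s b : ℕ) : ℕ :=
  if i + 1 = k then
    (if b = 0 then k + 1 else if s = x.d * (k - 1) then k - 1 else s % (k - 1))
  else if s = x.d * (k - 1) then k - 1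
  else if b = 0 then (if i < s % (k - 1) then k else s % (k - 1))
  else (if i = s % (k - 1) then k else s % (k - 1))

/-- The symbol of string `i` at position `p`: each slot has `n ^ a` positions, one for each
`a`-tuple of vectors. -/
def str (k a : ℕ) (x : OVInstance) (i p : ℕ) : ℕ :=
  x.symb k i (p / x.n ^ a)
    (digitProd (fun v => x.entry k i v (p / x.n ^ a)) x.n a (p % x.n ^ a))

theorem symb_lt {k : ℕ} (hk : 2 ≤ k) (x : OVInstance) (i s b : ℕ) : x.symb k i s b < k + 2 := by
  have := Nat.mod_lt s (show 0 < k - 1 by omega)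
  unfold symb
  split_ifs <;> omega

section strings

variable {k a : ℕ} (hk : 2 ≤ k) (x : OVInstance)

include hk

theorem str_lt_of_ne_last {i : ℕ} (hi : i < k - 1) (q : ℕ) : x.str k a i q < k + 1 := by
  have := Nat.mod_lt (q / x.n ^ a) (show 0 < k - 1 by omega)
  unfold str symb
  rw [if_neg (by omega)]
  split_ifs <;> omega

theorem div_eq_of_str_eq_sync {i q : ℕ} (hi : i < k - 1) (h : x.str k a i q = k - 1) :
    q / x.n ^ a = x.d * (k - 1) := by
  have := Nat.mod_lt (q / x.n ^ a) (show 0 < k - 1 by omega)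
  unfold str symb at h
  rw [if_neg (by omega)] at h
  split_ifs at h <;> omega

theorem of_str_eq_type {i q τ : ℕ} (hi : i < k - 1) (hτ : τ < k - 1) (h : x.str k a i q = τ) :
    q / x.n ^ a ≠ x.d * (k - 1) ∧ q / x.n ^ a % (k - 1) = τ ∧
    (i < τ → digitProd (fun v => x.bit v (q / x.n ^ a / (k - 1))) x.n a (q % x.n ^ a) ≠ 0) ∧
    (i = τ → digitProd (fun v => x.bit v (q / x.n ^ a / (k - 1))) x.n a (q % x.n ^ a) = 0) := by
  have := Nat.mod_lt (q / x.n ^ a) (show 0 < k - 1 by omega)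
  have he : ∀ v s, x.entry k i v s = x.bit v (s / (k - 1)) := fun v s => if_neg (by omega)
  unfold str symb at h
  simp only [he] at h
  rw [if_neg (by omega)] at h
  generalize digitProd _ _ _ _ = b at h ⊢
  split_ifs at h <;> refine ⟨?_, ?_, ?_, ?_⟩ <;> omega

theorem str_last (hn : 0 < x.n) (p : ℕ) : x.str k a (k - 1) p = if p % x.n ^ a = 0 then
    (if p / x.n ^ a = x.d * (k - 1) then k - 1 else p / x.n ^ a % (k - 1)) else k + 1 := by
  have he : ∀ v s, x.entry k (k - 1) v s = if v = 0 then 1 else 0 :=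
    fun v s => if_pos (by omega)
  unfold str symb
  simp only [he]
  rw [if_pos (by omega), digitProd_indicator_zero _ _ (Nat.mod_lt _ (Nat.pow_pos hn))]
  by_cases h : p % x.n ^ a = 0 <;> simp [h]

end strings

/-- The positions at which the last string agrees with all others, where string `i` is shifted by
`Δ i`. -/
def matchSet (k a : ℕ) (x : OVInstance) (Δ : ℕ → ℕ) : Finset ℕ :=
  (Finset.range (x.slots k * x.n ^ a)).filter fun p =>
    ∀ i < k - 1, x.str k a i ((p + Δ i) % (x.slots k * x.n ^ a)) = x.str k a (k - 1) p

section matchSet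

variable {k a : ℕ} (hk : 2 ≤ k) (x : OVInstance) (hn : 0 < x.n)

include hk hn

/-- A match is at the beginning of a slot. -/
theorem mod_eq_zero_of_mem_matchSet {Δ : ℕ → ℕ} {p : ℕ} (hp : p ∈ x.matchSet k a Δ) :
    p % x.n ^ a = 0 := by
  have h := (Finset.mem_filter.mp hp).2 0 (by omega)
  have hlt := str_lt_of_ne_last (a := a) hk x (show 0 < k - 1 by omega)
    ((p + Δ 0) % (x.slots k * x.n ^ a))
  rw [h, str_last hk x hn] at hlt
  by_contra h0
  rw [if_neg h0] at hlt
  exact lt_irrefl _ hlt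

omit hk in
theorem div_lt_slots {p : ℕ} (hp : p < x.slots k * x.n ^ a) : p / x.n ^ a < x.slots k :=
  (Nat.div_lt_iff_lt_mul (Nat.pow_pos hn)).mpr hp

/-- The slots of coordinate `j` are those with quotient `j` by `k - 1`; the last slot alone has the
quotient `x.d`. -/
theorem div_div_lt {p : ℕ} (hp : p < x.slots k * x.n ^ a) : p / x.n ^ a / (k - 1) < x.d + 1 := by
  have := div_lt_slots (a := a) x hn hp
  rw [Nat.div_lt_iff_lt_mul (by omega)]
  unfold slots at this
  nlinarith [show 1 ≤ k - 1 by omega]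

/-- In the slots of one coordinate there is at most one match, since the types of two matches would
require different bits of the string whose number is the smaller type. -/
theorem div_div_ne_of_lt {Δ : ℕ → ℕ} {p p' : ℕ} (hp : p ∈ x.matchSet k a Δ)
    (hp' : p' ∈ x.matchSet k a Δ) (hlt : p < p') :
    p / x.n ^ a / (k - 1) ≠ p' / x.n ^ a / (k - 1) := by
  intro h
  have hM : 0 < x.n ^ a := Nat.pow_pos hn
  have hN := Finset.mem_range.mp (Finset.mem_filter.mp hp).1
  have hN' := Finset.mem_range.mp (Finset.mem_filter.mp hp').1
  have h0 := mod_eq_zero_of_mem_matchSet hk x hn hp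
  have h0' := mod_eq_zero_of_mem_matchSet hk x hn hp'
  have hs' := div_lt_slots (a := a) x hn hN'
  have hm := (Finset.mem_filter.mp hp).2
  have hm' := (Finset.mem_filter.mp hp').2
  rw [str_last hk x hn, if_pos h0] at hm
  rw [str_last hk x hn, if_pos h0'] at hm'
  have es := Nat.div_add_mod p (x.n ^ a)
  have es' := Nat.div_add_mod p' (x.n ^ a)
  set M := x.n ^ a with hMdef
  set s := p / M
  set s' := p' / M
  rw [h0, Nat.add_zero] at es
  rw [h0', Nat.add_zero] at es'
  have hss : s < s' := by
    by_contra hc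
    have := Nat.mul_le_mul_left M (not_lt.mp hc)
    omega
  have eq := Nat.div_add_mod s (k - 1)
  have eq' := Nat.div_add_mod s' (k - 1)
  have hτ := Nat.mod_lt s (show 0 < k - 1 by omega)
  have hτ' := Nat.mod_lt s' (show 0 < k - 1 by omega)
  have hslots : x.slots k = x.d * (k - 1) + 1 := rfl
  have hs1 : s ≠ x.d * (k - 1) := by omega
  have hs1' : s' ≠ x.d * (k - 1) := by
    intro hc
    have h1 : s' / (k - 1) = x.d := by rw [hc, Nat.mul_div_cancel _ (by omega)]
    rw [h, h1, mul_comm] at eq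
    omega
  rw [if_neg hs1] at hm
  rw [if_neg hs1'] at hm'
  set τ := s % (k - 1)
  set τ' := s' % (k - 1)
  rw [h] at eq
  have hττ : τ < τ' := by omega
  have hd : s' = s + (τ' - τ) := by omega
  obtain ⟨a1, a2, -, a4⟩ := of_str_eq_type hk x hτ hτ (hm τ hτ)
  rw [← hMdef] at a1 a2 a4
  have hq : (p + Δ τ) % (x.slots k * M) < x.slots k * M :=
    Nat.mod_lt _ (Nat.mul_pos (by omega) hM)
  set q := (p + Δ τ) % (x.slots k * M) with hqdef
  have hu : q / M < x.slots k := (Nat.div_lt_iff_lt_mul hM).mpr hq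
  have equ := Nat.div_add_mod (q / M) (k - 1)
  rw [a2] at equ
  have hj1 : q / M / (k - 1) < x.d := by
    rw [Nat.div_lt_iff_lt_mul (by omega)]; omega
  have hj2 : (k - 1) * (q / M / (k - 1)) + (k - 1) ≤ x.d * (k - 1) := by
    have := Nat.mul_le_mul_left (k - 1) (Nat.succ_le_of_lt hj1)
    rw [Nat.mul_succ, mul_comm (k - 1) x.d] at this
    exact this
  -- The shifted string reads the slots of both matches within one coordinate, at the same offset.
  have hqq : (p' + Δ τ) % (x.slots k * M) = q + (τ' - τ) * M := by
    have h1 : p' + Δ τ = (p + Δ τ) + (τ' - τ) * M := by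
      rw [← es, ← es', hd]; ring
    have h2 : q + (τ' - τ) * M < x.slots k * M := by
      have h3 : q / M + (τ' - τ) + 1 ≤ x.slots k := by omega
      have h4 := Nat.mul_le_mul_right M h3
      have h5 := Nat.div_add_mod q M
      have h6 := Nat.mod_lt q hM
      nlinarith
    rw [h1, ← Nat.mod_add_mod, ← hqdef, Nat.mod_eq_of_lt h2]
  have h3 := hm' τ hτ
  rw [hqq] at h3
  obtain ⟨-, -, b3, -⟩ := of_str_eq_type hk x hτ hτ' h3
  refine b3 hττ ?_
  have e1 : (q + (τ' - τ) * M) / M = q / M + (τ' - τ) := Nat.add_mul_div_right _ _ hM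
  have e2 : (q + (τ' - τ) * M) % M = q % M := Nat.add_mul_mod_self_right _ _ _
  have e3 : (q / M + (τ' - τ)) / (k - 1) = q / M / (k - 1) := by
    rw [← equ, show (k - 1) * (q / M / (k - 1)) + τ + (τ' - τ) =
      τ' + (k - 1) * (q / M / (k - 1)) by omega, Nat.add_mul_div_left _ _ (by omega),
      Nat.div_eq_of_lt hτ', Nat.add_comm ((k - 1) * _) τ, Nat.add_mul_div_left _ _ (by omega),
      Nat.div_eq_of_lt hτ]
  rw [← hMdef, e1, e2, e3]
  exact a4 rfl

theorem injOn_matchSet (Δ : ℕ → ℕ) :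
    Set.InjOn (fun p => p / x.n ^ a / (k - 1)) (x.matchSet k a Δ : Set ℕ) := by
  intro p hp p' hp' h
  rcases lt_trichotomy p p' with hlt | heq | hlt
  · exact (div_div_ne_of_lt hk x hn hp hp' hlt h).elim
  · exact heq
  · exact (div_div_ne_of_lt hk x hn hp' hp hlt h.symm).elim

/-- If there are `x.d + 1` matches, then each coordinate has one, and so has the last slot. -/
theorem exists_match_of_le_card {Δ : ℕ → ℕ} (h : x.d + 1 ≤ (x.matchSet k a Δ).card) {j : ℕ}
    (hj : j < x.d + 1) : ∃ p ∈ x.matchSet k a Δ, p / x.n ^ a / (k - 1) = j := by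
  have himg : (x.matchSet k a Δ).image (fun p => p / x.n ^ a / (k - 1)) =
      Finset.range (x.d + 1) := by
    refine Finset.eq_of_subset_of_card_le (fun j hj => ?_) ?_
    · obtain ⟨p, hp, rfl⟩ := Finset.mem_image.mp hj
      exact Finset.mem_range.mpr
        (div_div_lt hk x hn (Finset.mem_range.mp (Finset.mem_filter.mp hp).1))
    · rw [Finset.card_image_of_injOn (injOn_matchSet hk x hn Δ), Finset.card_range]
      exact h
  have : j ∈ (x.matchSet k a Δ).image (fun p => p / x.n ^ a / (k - 1)) := by
    rw [himg]; exact Finset.mem_range.mpr hj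
  simpa using this

/-- A match in the synchronization slot keeps all shifts below the length of a slot. Then the shifts
are tuples of vectors, and a match in each coordinate shows their product to be zero. -/
theorem lt_and_exists_of_le_card {Δ : ℕ → ℕ} (hΔ : ∀ i, Δ i < x.slots k * x.n ^ a)
    (h : x.d + 1 ≤ (x.matchSet k a Δ).card) :
    (∀ i < k - 1, Δ i < x.n ^ a) ∧
      ∀ j < x.d, ∃ i < k - 1, digitProd (fun v => x.bit v j) x.n a (Δ i) = 0 := by
  have hM : 0 < x.n ^ a := Nat.pow_pos hn
  have hslots : x.slots k = x.d * (k - 1) + 1 := rfl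
  have hN : x.slots k * x.n ^ a = x.n ^ a * (x.d * (k - 1)) + x.n ^ a := by rw [hslots]; ring
  have hsmall : ∀ i < k - 1, Δ i < x.n ^ a := by
    intro i hi
    obtain ⟨p, hp, hpj⟩ := exists_match_of_le_card hk x hn h (Nat.lt_succ_self _)
    have hpN := Finset.mem_range.mp (Finset.mem_filter.mp hp).1
    have h0 := mod_eq_zero_of_mem_matchSet hk x hn hp
    have hs := div_lt_slots (a := a) x hn hpN
    have hm := (Finset.mem_filter.mp hp).2 i hi
    have es := Nat.div_add_mod p (x.n ^ a)
    have eq := Nat.div_add_mod (p / x.n ^ a) (k - 1)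
    rw [hpj, mul_comm] at eq
    have hs1 : p / x.n ^ a = x.d * (k - 1) := by omega
    rw [str_last hk x hn, if_pos h0, if_pos hs1] at hm
    have hdiv := div_eq_of_str_eq_sync hk x hi hm
    rw [h0, hs1, Nat.add_zero] at es
    have hΔi := hΔ i
    by_contra hc
    have h1 : (p + Δ i) % (x.slots k * x.n ^ a) = Δ i - x.n ^ a := by
      rw [Nat.mod_eq_sub_mod (by omega), Nat.mod_eq_of_lt (by omega)]
      omega
    have h2 := Nat.div_mul_le_self ((p + Δ i) % (x.slots k * x.n ^ a)) (x.n ^ a)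
    rw [hdiv, h1, mul_comm] at h2
    omega
  refine ⟨hsmall, fun j hj => ?_⟩
  obtain ⟨p, hp, hpj⟩ := exists_match_of_le_card hk x hn h (show j < x.d + 1 by omega)
  have h0 := mod_eq_zero_of_mem_matchSet hk x hn hp
  have hs1 : p / x.n ^ a ≠ x.d * (k - 1) := by
    intro hc
    rw [hc, Nat.mul_div_cancel _ (by omega)] at hpj
    omega
  have hτ := Nat.mod_lt (p / x.n ^ a) (show 0 < k - 1 by omega)
  have hm := (Finset.mem_filter.mp hp).2 _ hτ
  have hpN := Finset.mem_range.mp (Finset.mem_filter.mp hp).1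
  have hs := div_lt_slots (a := a) x hn hpN
  have hsm := hsmall _ hτ
  rw [str_last hk x hn, if_pos h0, if_neg hs1] at hm
  have es := Nat.div_add_mod p (x.n ^ a)
  rw [h0, Nat.add_zero] at es
  refine ⟨_, hτ, ?_⟩
  generalize p / x.n ^ a % (k - 1) = τ at hτ hm hsm ⊢
  have hle := Nat.mul_le_mul_left (x.n ^ a) (show p / x.n ^ a + 1 ≤ x.d * (k - 1) by omega)
  rw [Nat.mul_succ] at hle
  rw [Nat.mod_eq_of_lt (by omega)] at hm
  have h4 := (of_str_eq_type hk x hτ hτ hm).2.2.2 rfl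
  have e1 : (p + Δ τ) / x.n ^ a = p / x.n ^ a := by
    rw [← es, Nat.mul_add_div hM, Nat.div_eq_of_lt hsm, Nat.mul_div_cancel_left _ hM, Nat.add_zero]
  have e2 : (p + Δ τ) % x.n ^ a = Δ τ := by
    rw [← es, Nat.mul_add_mod, Nat.mod_eq_of_lt hsm]
  rwa [e1, e2, hpj] at h4

/-- Shifting by tuples whose product is zero in all coordinates gives a match in each coordinate and
in the last slot. -/
theorem le_card_of_exists {t : ℕ → ℕ} (ht : ∀ i < k - 1, t i < x.n ^ a)
    (h : ∀ j < x.d, ∃ i < k - 1, digitProd (fun v => x.bit v j) x.n a (t i) = 0) :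
    x.d + 1 ≤ (x.matchSet k a t).card := by
  have hM : 0 < x.n ^ a := Nat.pow_pos hn
  have hslots : x.slots k = x.d * (k - 1) + 1 := rfl
  -- A slot gives a match as soon as all strings have there the symbol of the slot.
  have key : ∀ s < x.slots k,
      (∀ i < k - 1, x.symb k i s (digitProd (fun v => x.bit v (s / (k - 1))) x.n a (t i)) =
        if s = x.d * (k - 1) then k - 1 else s % (k - 1)) →
      s / (k - 1) ∈ (x.matchSet k a t).image fun p => p / x.n ^ a / (k - 1) := by
    intro s hs hsym
    have hle := Nat.mul_le_mul_right (x.n ^ a) (Nat.succ_le_of_lt hs)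
    rw [Nat.succ_mul] at hle
    refine Finset.mem_image.mpr ⟨s * x.n ^ a, Finset.mem_filter.mpr
      ⟨Finset.mem_range.mpr (by omega), fun i hi => ?_⟩, ?_⟩
    · have hti := ht i hi
      have he : ∀ v s, x.entry k i v s = x.bit v (s / (k - 1)) := fun v s => if_neg (by omega)
      rw [Nat.mod_eq_of_lt (by omega), str_last hk x hn, if_pos (Nat.mul_mod_left _ _),
        Nat.mul_div_cancel _ hM, ← hsym i hi, mul_comm]
      unfold str
      rw [Nat.mul_add_div hM, Nat.div_eq_of_lt hti, Nat.mul_add_mod, Nat.mod_eq_of_lt hti]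
      simp only [he, Nat.add_zero]
    · simp only [Nat.mul_div_cancel _ hM]
  have hsub : Finset.range (x.d + 1) ⊆
      (x.matchSet k a t).image fun p => p / x.n ^ a / (k - 1) := by
    intro j hj
    rcases Nat.lt_succ_iff_lt_or_eq.mp (Finset.mem_range.mp hj) with hjd | rfl
    · -- The type of the slot is the first string whose bit is zero.
      classical
      have hex := h j hjd
      obtain ⟨hτ, hz⟩ := Nat.find_spec hex
      have hmin := fun i (hi : i < Nat.find hex) => Nat.find_min hex hi
      generalize Nat.find hex = τ at hτ hz hmin
      have e1 : (j * (k - 1) + τ) / (k - 1) = j := by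
        rw [mul_comm, Nat.mul_add_div (by omega), Nat.div_eq_of_lt hτ, Nat.add_zero]
      have e2 : (j * (k - 1) + τ) % (k - 1) = τ := by
        rw [mul_comm, Nat.mul_add_mod, Nat.mod_eq_of_lt hτ]
      have hlt : j * (k - 1) + τ < x.d * (k - 1) := by
        have := Nat.mul_le_mul_right (k - 1) (Nat.succ_le_of_lt hjd)
        rw [Nat.succ_mul] at this
        omega
      have := key (j * (k - 1) + τ) (by omega) fun i hi => by
        rw [e1, if_neg (by omega), e2]
        unfold symb
        rw [if_neg (by omega), if_neg (by omega), e2]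
        by_cases hb : digitProd (fun v => x.bit v j) x.n a (t i) = 0
        · rw [if_pos hb, if_neg fun hiτ => hmin i hiτ ⟨hi, hb⟩]
        · rw [if_neg hb, if_neg]
          rintro rfl
          exact hb hz
      rwa [e1] at this
    · have := key (x.d * (k - 1)) (by omega) fun i hi => by
        unfold symb
        rw [if_neg (by omega), if_pos rfl, if_pos rfl]
      rwa [Nat.mul_div_cancel _ (by omega)] at this
  calc x.d + 1 = (Finset.range (x.d + 1)).card := (Finset.card_range _).symm
    _ ≤ _ := Finset.card_le_card hsub
    _ ≤ _ := Finset.card_image_le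

end matchSet

end OVInstance

/-! ### Lists made of blocks -/

theorem getD_flatMap_of_length {α : Type*} {Λ : ℕ} (hΛ : 0 < Λ) (l : List α) (f : α → List ℕ)
    (hf : ∀ u ∈ l, (f u).length = Λ) (A : ℕ) :
    (l.flatMap f).getD A 0 = ((l.map f).getD (A / Λ) []).getD (A % Λ) 0 := by
  induction l generalizing A with
  | nil => simp
  | cons u l ih =>
    have hu := hf u List.mem_cons_self
    rw [List.flatMap_cons, List.map_cons]
    by_cases hA : A < Λ
    · rw [List.getD_append _ _ _ _ (by omega), Nat.div_eq_of_lt hA, Nat.mod_eq_of_lt hA,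
        List.getD_cons_zero]
    · rw [List.getD_append_right _ _ _ _ (by omega), hu,
        ih (fun v hv => hf v (List.mem_cons_of_mem _ hv))]
      obtain ⟨B, rfl⟩ := Nat.exists_eq_add_of_le (not_lt.mp hA)
      rw [Nat.add_sub_cancel_left, Nat.add_div_left _ hΛ, Nat.add_mod_left, List.getD_cons_succ]

theorem getD_flatMap_ofFn {α : Type*} {Λ k : ℕ} (hΛ : 0 < Λ) (g : Fin k → α) (f : α → List ℕ)
    (hf : ∀ i, (f (g i)).length = Λ) (A : ℕ) :
    ((List.ofFn g).flatMap f).getD A 0 =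
      if h : A / Λ < k then (f (g ⟨A / Λ, h⟩)).getD (A % Λ) 0 else 0 := by
  rw [getD_flatMap_of_length hΛ _ _ (by simpa [List.mem_ofFn] using hf)]
  split_ifs with h
  · rw [List.getD_eq_getElem (l := List.map f (List.ofFn g)) (hn := by simpa using h)]
    simp
  · rw [List.getD_eq_default (l := List.map f (List.ofFn g)) (hn := by simpa using h)]
    simp

theorem flatMap_range_map {α : Type*} (m b : ℕ) (h : ℕ → α) :
    ((List.range m).flatMap fun v => (List.range b).map fun t => h (v * b + t)) =
      (List.range (m * b)).map h := by
  induction m with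
  | zero => simp
  | succ m ih =>
    rw [List.range_succ, List.flatMap_append, ih, Nat.succ_mul, List.range_add, List.map_append]
    simp

theorem getD_map_range {m : ℕ} (g : ℕ → ℕ) {r : ℕ} (hr : r < m) :
    ((List.range m).map g).getD r 0 = g r := by
  rw [List.getD_eq_getElem (hn := by simpa using hr)]
  simp

/-! ### The words of the input -/

namespace OVInstance

variable (x : OVInstance)

theorem length_input : x.input.length = 2 + x.n * x.d := by
  simp [input, List.length_flatMap, Function.comp_def, List.ofFn_const]
  omega

theorem bit_le_one (v j : ℕ) : x.bit v j ≤ 1 := by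
  have h : ∀ b ∈ (List.ofFn x.L).flatMap fun v => (List.ofFn v).map Bool.toNat, b ≤ 1 := by
    intro b hb
    obtain ⟨v, -, hb⟩ := List.mem_flatMap.mp hb
    obtain ⟨b, -, rfl⟩ := List.mem_map.mp hb
    exact Bool.toNat_le b
  unfold bit input
  rw [Nat.add_comm, List.getD_cons_succ, List.getD_cons_succ]
  generalize (List.ofFn x.L).flatMap (fun v => (List.ofFn v).map Bool.toNat) = l at h
  by_cases hl : v * x.d + j < l.length
  · rw [List.getD_eq_getElem (hn := hl)]
    exact h _ (List.getElem_mem hl)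
  · rw [List.getD_eq_default (hn := not_lt.mp hl)]
    exact Nat.zero_le 1

theorem bit_eq (v : Fin x.n) (j : Fin x.d) : x.bit v j = (x.L v j).toNat := by
  have hd : 0 < x.d := by have := j.isLt; omega
  have e1 : ((v : ℕ) * x.d + j) / x.d = v := by
    rw [mul_comm, Nat.mul_add_div hd, Nat.div_eq_of_lt j.isLt, Nat.add_zero]
  have e2 : ((v : ℕ) * x.d + j) % x.d = j := by
    rw [mul_comm, Nat.mul_add_mod, Nat.mod_eq_of_lt j.isLt]
  unfold bit input
  rw [Nat.add_comm, List.getD_cons_succ, List.getD_cons_succ,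
    getD_flatMap_ofFn hd _ _ (by simp), dif_pos (by rw [e1]; exact v.isLt),
    e2, List.getD_eq_getElem (l := List.map _ _) (hn := by simp)]
  simp [e1]

theorem getD_input_lt (i : ℕ) : x.input.getD i 0 < x.n + x.d + 2 := by
  match i with
  | 0 => simp only [input, List.getD_cons_zero]; omega
  | 1 => simp only [input, List.getD_cons_succ, List.getD_cons_zero]; omega
  | i + 2 =>
    have := x.bit_le_one 0 i
    rw [bit, Nat.zero_mul, Nat.zero_add, Nat.add_comm] at this
    omega

theorem entry_le_one (k i v s : ℕ) : x.entry k i v s ≤ 1 := by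
  unfold entry
  split_ifs
  · exact le_rfl
  · exact Nat.zero_le 1
  · exact x.bit_le_one _ _

/-! ### Straight-line programs for the strings -/

/-- The symbol that expands to the contents of slot `s` of string `i`, restricted to the last `l`
digits of the tuple, when `c` is the product of the bits of the other digits. -/
def slpSym (k i l s c : ℕ) : ℕ :=
  if l = 0 then x.symb k i s c else k + 2 + (((l - 1) * x.slots k + s) * 2 + c)

/-- The symbol `v` of rule `r`. The rule for `slpSym k i (l + 1) s c` has the number
`(l * x.slots k + s) * 2 + c`, and its symbols correspond to the values of the first digit. -/
def ruleSym (k i r v : ℕ) : ℕ :=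
  x.slpSym k i (r / (2 * x.slots k)) (r / 2 % x.slots k)
    (r % 2 * x.entry k i v (r / 2 % x.slots k))

theorem slots_pos (k : ℕ) : 0 < x.slots k := Nat.succ_pos _

theorem slpSym_lt {k : ℕ} (hk : 2 ≤ k) (i l s c : ℕ) (hs : s < x.slots k) (hc : c ≤ 1) :
    x.slpSym k i l s c < k + 2 + 2 * x.slots k * l := by
  unfold slpSym
  split_ifs with hl
  · exact (x.symb_lt hk i s c).trans_le (Nat.le_add_right _ _)
  · obtain ⟨l, rfl⟩ := Nat.exists_eq_succ_of_ne_zero hl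
    rw [Nat.succ_sub_one, Nat.mul_succ]
    nlinarith

/-- A straight-line program for string `i`: a rule for each number of digits, each slot and each
bit, and a last rule that concatenates the slots. -/
def slp {k : ℕ} (hk : 2 ≤ k) (a : ℕ) (hn : 0 < x.n) (i : ℕ) : SLP (k + 2) where
  rules := (List.range (2 * x.slots k * a)).map (fun r => (List.range x.n).map (x.ruleSym k i r)) ++
    [(List.range (x.slots k)).map fun s => x.slpSym k i a s 1]
  start := k + 2 + 2 * x.slots k * a
  rules_ne_nil r hr := by
    rcases List.mem_append.mp hr with hr | hr
    · obtain ⟨r, -, rfl⟩ := List.mem_map.mp hr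
      simpa using hn.ne'
    · rw [List.mem_singleton.mp hr]
      simpa using (x.slots_pos k).ne'
  ordered j hj B hB := by
    have hs := x.slots_pos k
    rw [List.length_append, List.length_map, List.length_range, List.length_singleton] at hj
    by_cases hj' : j < 2 * x.slots k * a
    · rw [List.getElem_append_left (by simpa using hj')] at hB
      simp only [List.getElem_map, List.getElem_range, List.mem_map] at hB
      obtain ⟨v, -, rfl⟩ := hB
      have h1 := x.slpSym_lt hk i (j / (2 * x.slots k)) (j / 2 % x.slots k)
        (j % 2 * x.entry k i v (j / 2 % x.slots k)) (Nat.mod_lt _ hs)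
        (Nat.mul_le_mul (Nat.le_of_lt_succ (Nat.mod_lt j (by omega))) (x.entry_le_one k i v _))
      have h2 := Nat.mul_div_le j (2 * x.slots k)
      exact h1.trans_le (by omega)
    · rw [List.getElem_append_right (by simpa using hj')] at hB
      simp only [List.getElem_singleton, List.mem_map, List.mem_range] at hB
      obtain ⟨s, hs, rfl⟩ := hB
      exact (x.slpSym_lt hk i a s 1 hs le_rfl).trans_le (by omega)
  start_lt := by simp

section slp

variable {k : ℕ} (hk : 2 ≤ k) (a : ℕ) (hn : 0 < x.n) (i : ℕ)

theorem length_rules_slp : (x.slp hk a hn i).rules.length = 2 * x.slots k * a + 1 := by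
  simp [slp]

theorem exp_slpSym (l s c : ℕ) (hl : l ≤ a) (hs : s < x.slots k) (hc : c ≤ 1) :
    (x.slp hk a hn i).exp (x.slpSym k i l s c) = (List.range (x.n ^ l)).map fun t =>
      x.symb k i s (c * digitProd (fun v => x.entry k i v s) x.n l t) := by
  induction l generalizing c with
  | zero => simp [slpSym, SLP.exp_terminal _ (x.symb_lt hk i s c), digitProd]
  | succ l ih =>
    have hr : (l * x.slots k + s) * 2 + c < 2 * x.slots k * a := by
      have := Nat.mul_le_mul_left (x.slots k) hl
      nlinarith
    have hpos := x.slots_pos k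
    have e1 : ((l * x.slots k + s) * 2 + c) / (2 * x.slots k) = l := by
      rw [← Nat.div_div_eq_div_mul, show ((l * x.slots k + s) * 2 + c) / 2 = l * x.slots k + s by
        omega, mul_comm, Nat.mul_add_div hpos, Nat.div_eq_of_lt hs, Nat.add_zero]
    have e2 : ((l * x.slots k + s) * 2 + c) / 2 % x.slots k = s := by
      rw [show ((l * x.slots k + s) * 2 + c) / 2 = l * x.slots k + s by omega, mul_comm,
        Nat.mul_add_mod, Nat.mod_eq_of_lt hs]
    have e3 : ((l * x.slots k + s) * 2 + c) % 2 = c := by omega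
    have hsym : x.slpSym k i (l + 1) s c = k + 2 + ((l * x.slots k + s) * 2 + c) := by
      simp [slpSym]
    have hlen : (l * x.slots k + s) * 2 + c < (x.slp hk a hn i).rules.length := by
      rw [length_rules_slp]; omega
    have hrule : (x.slp hk a hn i).rules[(l * x.slots k + s) * 2 + c] =
        (List.range x.n).map fun v => x.slpSym k i l s (c * x.entry k i v s) := by
      simp only [slp]
      rw [List.getElem_append_left (by simpa using hr)]
      simp only [List.getElem_map, List.getElem_range]
      refine List.map_congr_left fun v _ => ?_
      rw [ruleSym, e1, e2, e3]
    rw [hsym, SLP.exp_nonterminal _ _ hlen, hrule, List.flatMap_map, pow_succ, mul_comm,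
      ← flatMap_range_map]
    refine List.flatMap_congr fun v _ => ?_
    rw [ih _ (by omega) (Nat.mul_le_mul hc (x.entry_le_one k i v s))]
    refine List.map_congr_left fun t ht => ?_
    have ht' : t < x.n ^ l := List.mem_range.mp ht
    rw [digitProd, mul_comm v, Nat.mul_add_div (Nat.pow_pos hn), Nat.div_eq_of_lt ht',
      Nat.mul_add_mod, Nat.mod_eq_of_lt ht', Nat.add_zero, mul_assoc]

theorem exp_start_slp : (x.slp hk a hn i).exp (x.slp hk a hn i).start =
    (List.range (x.slots k * x.n ^ a)).map (x.str k a i) := by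
  have hlen : 2 * x.slots k * a < (x.slp hk a hn i).rules.length := by
    rw [length_rules_slp]; omega
  have hrule : (x.slp hk a hn i).rules[2 * x.slots k * a] =
      (List.range (x.slots k)).map fun s => x.slpSym k i a s 1 := by
    simp [slp]
  rw [show (x.slp hk a hn i).start = k + 2 + 2 * x.slots k * a from rfl,
    SLP.exp_nonterminal _ _ hlen, hrule, List.flatMap_map, ← flatMap_range_map]
  refine List.flatMap_congr fun s hs => ?_
  rw [exp_slpSym _ _ _ _ _ _ _ _ le_rfl (List.mem_range.mp hs) le_rfl]
  refine List.map_congr_left fun t ht => ?_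
  have ht' : t < x.n ^ a := List.mem_range.mp ht
  rw [str, mul_comm s, Nat.mul_add_div (Nat.pow_pos hn), Nat.div_eq_of_lt ht',
    Nat.mul_add_mod, Nat.mod_eq_of_lt ht', Nat.add_zero, one_mul]

theorem size_slp : (x.slp hk a hn i).size =
    k + 2 + (2 * x.slots k * a + 1) + (2 * x.slots k * a * x.n + x.slots k) := by
  rw [SLP.size, length_rules_slp]
  simp [slp, Function.comp_def]

/-- The number of words that describe the straight-line program of a string. -/
def codeLength (k a : ℕ) : ℕ := 2 + 2 * x.slots k * a * (x.n + 1) + (1 + x.slots k)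

/-- Word `r` of the description of the straight-line program for string `i`. -/
def codeWord (k a i r : ℕ) : ℕ :=
  if r = 0 then 2 * x.slots k * a + 1
  else if r = 1 then k + 2 + 2 * x.slots k * a
  else if r - 2 < 2 * x.slots k * a * (x.n + 1) then
    (if (r - 2) % (x.n + 1) = 0 then x.n
      else x.ruleSym k i ((r - 2) / (x.n + 1)) ((r - 2) % (x.n + 1) - 1))
  else if r - 2 = 2 * x.slots k * a * (x.n + 1) then x.slots k
  else x.slpSym k i a (r - 2 - 2 * x.slots k * a * (x.n + 1) - 1) 1

theorem length_code_slp : (x.slp hk a hn i).code.length = x.codeLength k a := by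
  rw [SLP.code, codeLength]
  simp [slp, List.length_flatMap, Function.comp_def]
  ring

theorem getD_code_slp {r : ℕ} (hr : r < x.codeLength k a) :
    (x.slp hk a hn i).code.getD r 0 = x.codeWord k a i r := by
  have hcode : (x.slp hk a hn i).code = (2 * x.slots k * a + 1) :: (k + 2 + 2 * x.slots k * a) ::
      (((List.range (2 * x.slots k * a)).flatMap
        (fun r => x.n :: (List.range x.n).map (x.ruleSym k i r))) ++
      (x.slots k :: (List.range (x.slots k)).map fun s => x.slpSym k i a s 1)) := by
    rw [SLP.code, length_rules_slp]
    simp [slp, List.flatMap_map, List.flatMap_append]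
  have hlen : ((List.range (2 * x.slots k * a)).flatMap
      (fun r => x.n :: (List.range x.n).map (x.ruleSym k i r))).length =
      2 * x.slots k * a * (x.n + 1) := by
    simp [List.length_flatMap]
  rw [hcode]
  match r with
  | 0 => rfl
  | 1 => rfl
  | r + 2 =>
    rw [List.getD_cons_succ, List.getD_cons_succ, codeWord, if_neg (by omega), if_neg (by omega),
      Nat.add_sub_cancel]
    split_ifs with h1 h2 h3
    all_goals first
      | rw [List.getD_append _ _ _ _ (by omega),
          getD_flatMap_of_length (Λ := x.n + 1) (by omega) _ _ (by simp),
          List.getD_eq_getElem (l := List.map _ _)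
            (hn := by simpa [Nat.div_lt_iff_lt_mul] using h1)]
        simp only [List.getElem_map, List.getElem_range]
      | rw [List.getD_append_right _ _ _ _ (by omega), hlen]
    · rw [h2, List.getD_cons_zero]
    · obtain ⟨u, hu⟩ := Nat.exists_eq_succ_of_ne_zero h2
      have : r % (x.n + 1) < x.n + 1 := Nat.mod_lt _ (by omega)
      rw [hu, Nat.succ_eq_add_one, List.getD_cons_succ, Nat.add_sub_cancel,
        getD_map_range _ (by omega)]
    · rw [h3, Nat.sub_self, List.getD_cons_zero]
    · obtain ⟨u, hu⟩ := Nat.exists_eq_succ_of_ne_zero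
        (show r - 2 * x.slots k * a * (x.n + 1) ≠ 0 by omega)
      unfold codeLength at hr
      rw [hu, Nat.succ_eq_add_one, List.getD_cons_succ, Nat.add_sub_cancel,
        getD_map_range _ (by omega)]

end slp

/-! ### The reduction -/

/-- The instance of shift distance that belongs to an instance of orthogonal vectors. -/
def sdInstance {k : ℕ} (hk : 2 ≤ k) (a : ℕ) (x : OVInstance) : SDInstance k (k + 2) where
  N := x.slots k * x.n ^ a
  X i p := ⟨x.str k a i p, x.symb_lt hk _ _ _⟩

/-- The instance `sdInstance` together with straight-line programs for its strings. -/
def compressedInstance {k : ℕ} (hk : 2 ≤ k) (a : ℕ) (x : OVInstance) (hn : 0 < x.n) :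
    CompressedSDInstance k (k + 2) where
  toSDInstance := x.sdInstance hk a
  G i := x.slp hk a hn i
  represents i := by
    rw [SLP.Represents, exp_start_slp]
    refine List.ext_getElem ?_ fun p hp hp' => ?_
    · simp [sdInstance]
    · simp [sdInstance]

/-- The vectors that are sought, grouped into `k - 1` tuples of length `a`. -/
theorem isYes_iff (a k : ℕ) (x : OVInstance) : x.IsYes (a * (k - 1)) ↔
    ∃ t : ℕ → ℕ, (∀ i < k - 1, t i < x.n ^ a) ∧
      ∀ j < x.d, ∃ i < k - 1, digitProd (fun v => x.bit v j) x.n a (t i) = 0 := by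
  constructor
  · rintro ⟨v, hv⟩
    choose t ht h using fun i : Fin (k - 1) =>
      exists_digitProd_eq_prod a fun l => v (finProdFinEquiv (l, i))
    refine ⟨fun i => if hi : i < k - 1 then t ⟨i, hi⟩ else 0, fun i hi => ?_, fun j hj => ?_⟩
    · simpa only [dif_pos hi] using ht ⟨i, hi⟩
    · obtain ⟨e, -, he⟩ := Finset.prod_eq_zero_iff.mp (hv ⟨j, hj⟩)
      obtain ⟨⟨l, i⟩, rfl⟩ := finProdFinEquiv.surjective e
      refine ⟨i, i.isLt, ?_⟩
      simp only [dif_pos i.isLt]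
      rw [h]
      refine Finset.prod_eq_zero (Finset.mem_univ l) ?_
      rw [← he]
      exact x.bit_eq _ ⟨j, hj⟩
  · rintro ⟨t, ht, h⟩
    choose w hw using fun i : Fin (k - 1) => exists_digits a (t i) (ht i i.isLt)
    refine ⟨fun e => w (finProdFinEquiv.symm e).2 (finProdFinEquiv.symm e).1, fun j => ?_⟩
    obtain ⟨i, hi, hz⟩ := h j j.isLt
    rw [hw ⟨i, hi⟩] at hz
    obtain ⟨l, -, hl⟩ := Finset.prod_eq_zero_iff.mp hz
    refine Finset.prod_eq_zero (Finset.mem_univ (finProdFinEquiv (l, ⟨i, hi⟩))) ?_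
    simp only [Equiv.symm_apply_apply]
    rw [← hl]
    exact (x.bit_eq _ j).symm

section score

variable {k : ℕ} (hk : 2 ≤ k) (a : ℕ) (x : OVInstance)

theorem offsetScore_eq (Δ : Fin k → Fin (x.sdInstance hk a).N) (Δ' : ℕ → ℕ)
    (h : ∀ i : Fin k, (i : ℕ) < k - 1 → Δ' i = Δ i)
    (h0 : ∀ i : Fin k, (i : ℕ) + 1 = k → (Δ i : ℕ) = 0) :
    offsetScore (x.sdInstance hk a).X Δ = (x.matchSet k a Δ').card := by
  rw [offsetScore, ← Finset.card_image_of_injective _ Fin.val_injective]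
  congr 1
  ext p
  simp only [Finset.mem_image, Finset.mem_filter, Finset.mem_univ, true_and, matchSet,
    Finset.mem_range]
  have hval : ∀ (i : Fin k) (q : Fin (x.sdInstance hk a).N),
      (((x.sdInstance hk a).X i (q + Δ i) : Fin (k + 2)) : ℕ) =
        x.str k a i ((q + Δ i) % (x.slots k * x.n ^ a)) := fun i q => by
    rw [← show ((q + Δ i : Fin (x.sdInstance hk a).N) : ℕ) =
      ((q : ℕ) + Δ i) % (x.slots k * x.n ^ a) from Fin.val_add _ _]
    rfl
  have hlast : ∀ q : Fin (x.sdInstance hk a).N, ∀ i : Fin k, (i : ℕ) + 1 = k →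
      (((x.sdInstance hk a).X i (q + Δ i) : Fin (k + 2)) : ℕ) = x.str k a (k - 1) q :=
    fun q i hi => by
      rw [hval, h0 i hi, Nat.add_zero, show (i : ℕ) = k - 1 by omega]
      congr 1
      exact Nat.mod_eq_of_lt q.isLt
  constructor
  · rintro ⟨q, hq, rfl⟩
    refine ⟨q.isLt, fun i hi => ?_⟩
    rw [← hlast q ⟨k - 1, by omega⟩ (by simp only; omega), ← hq ⟨i, by omega⟩, hval,
      h ⟨i, by omega⟩ hi]
  · rintro ⟨hp, hm⟩
    have key : ∀ i : Fin k,
        (((x.sdInstance hk a).X i (⟨p, hp⟩ + Δ i) : Fin (k + 2)) : ℕ) = x.str k a (k - 1) p := by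
      intro i
      by_cases hi : (i : ℕ) + 1 = k
      · exact hlast _ i hi
      · have hi' : (i : ℕ) < k - 1 := by have := i.isLt; omega
        rw [hval, ← hm i hi', h i hi']
    exact ⟨⟨p, hp⟩, fun i j => Fin.ext ((key i).trans (key j).symm), rfl⟩

/-- The shift distance exceeds the dimension exactly if there are orthogonal vectors. -/
theorem lt_shiftDistance_iff (hn : 0 < x.n) :
    x.d < shiftDistance (x.sdInstance hk a).X ↔ x.IsYes (a * (k - 1)) := by
  have hM : 0 < x.n ^ a := Nat.pow_pos hn
  have hN : x.n ^ a ≤ (x.sdInstance hk a).N := Nat.le_mul_of_pos_left _ (x.slots_pos k)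
  rw [isYes_iff, shiftDistance, Finset.lt_sup_iff]
  simp only [Finset.mem_filter, Finset.mem_univ, true_and]
  constructor
  · rintro ⟨Δ, h0, h⟩
    rw [x.offsetScore_eq hk a Δ (fun i => if hi : i < k then (Δ ⟨i, hi⟩ : ℕ) else 0)
      (fun i _ => dif_pos i.isLt) h0] at h
    refine ⟨_, lt_and_exists_of_le_card hk x hn (fun i => ?_) h⟩
    split_ifs with hi
    · exact (Δ ⟨i, hi⟩).isLt
    · exact hM.trans_le hN
  · rintro ⟨t, ht, h⟩
    refine ⟨fun i => if hi : (i : ℕ) < k - 1 then ⟨t i, (ht i hi).trans_le hN⟩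
      else ⟨0, hM.trans_le hN⟩, fun i hi => ?_, ?_⟩
    · simp only [dif_neg (show ¬(i : ℕ) < k - 1 by omega)]
    · rw [x.offsetScore_eq hk a _ t (fun i hi => by rw [dif_pos hi])
        (fun i hi => by rw [dif_neg (by omega)])]
      exact le_card_of_exists hk x hn ht h

end score

end OVInstance

/-! ### Computing single words of the reduction -/

namespace WordExpr

/-- The number of vectors. -/
def vectors : WordExpr := load (num 0)

/-- The dimension of the vectors. -/
def dimension : WordExpr := load (num 1)

/-- See `OVInstance.bit`. The range check keeps the access inside the input, since the cells behind
it are in use by `Prog.lazy`. -/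
def bit (v j : WordExpr) : WordExpr :=
  ifLt (num 2 + (v * dimension + j)) (num 2 + vectors * dimension)
    (load (num 2 + (v * dimension + j))) (num 0)

/-- See `OVInstance.slots`. -/
def slots (k : ℕ) : WordExpr := dimension * num (k - 1) + num 1

/-- See `OVInstance.entry`. -/
def entry (k : ℕ) (i v s : WordExpr) : WordExpr :=
  ifEq (i + num 1) (num k) (ifEq v (num 0) (num 1) (num 0)) (bit v (s / num (k - 1)))

/-- See `OVInstance.symb`. -/
def symb (k : ℕ) (i s b : WordExpr) : WordExpr :=
  ifEq (i + num 1) (num k)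
    (ifEq b (num 0) (num (k + 1)) (ifEq s (dimension * num (k - 1)) (num (k - 1))
      (s % num (k - 1))))
    (ifEq s (dimension * num (k - 1)) (num (k - 1))
      (ifEq b (num 0) (ifLt i (s % num (k - 1)) (num k) (s % num (k - 1)))
        (ifEq i (s % num (k - 1)) (num k) (s % num (k - 1)))))

/-- See `KSD.digitProd`. -/
def digitProd (B : WordExpr → WordExpr) : ℕ → WordExpr → WordExpr
  | 0, _ => num 1
  | l + 1, t => B (t / npow vectors l) * digitProd B l (t % npow vectors l)

/-- See `OVInstance.str`. -/
def str (k a : ℕ) (i p : WordExpr) : WordExpr :=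
  symb k i (p / npow vectors a)
    (digitProd (fun v => entry k i v (p / npow vectors a)) a (p % npow vectors a))

/-- See `OVInstance.slpSym`. -/
def slpSym (k : ℕ) (i l s c : WordExpr) : WordExpr :=
  ifEq l (num 0) (symb k i s c)
    (num (k + 2) + (((l - num 1) * slots k + s) * num 2 + c))

/-- See `OVInstance.ruleSym`. -/
def ruleSym (k : ℕ) (i r v : WordExpr) : WordExpr :=
  slpSym k i (r / (num 2 * slots k)) (r / num 2 % slots k)
    (r % num 2 * entry k i v (r / num 2 % slots k))

/-- See `OVInstance.codeLength`. -/
def codeLength (k a : ℕ) : WordExpr :=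
  num 2 + num 2 * slots k * num a * (vectors + num 1) + (num 1 + slots k)

/-- See `OVInstance.codeWord`. -/
def codeWord (k a : ℕ) (i r : WordExpr) : WordExpr :=
  ifEq r (num 0) (num 2 * slots k * num a + num 1)
  (ifEq r (num 1) (num (k + 2) + num 2 * slots k * num a)
  (ifLt (r - num 2) (num 2 * slots k * num a * (vectors + num 1))
    (ifEq ((r - num 2) % (vectors + num 1)) (num 0) vectors
      (ruleSym k i ((r - num 2) / (vectors + num 1)) ((r - num 2) % (vectors + num 1) - num 1)))
  (ifEq (r - num 2) (num 2 * slots k * num a * (vectors + num 1)) (slots k)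
    (slpSym k i (num a) (r - num 2 - num 2 * slots k * num a * (vectors + num 1) - num 1)
      (num 1)))))

/-- The word with address `A` of an input that consists of the length of the strings and of `k`
blocks of length `Λ`, where `F i r` is the word `r` of block `i`. -/
def blockInput (k a : ℕ) (Λ : WordExpr) (F : WordExpr → WordExpr → WordExpr) (A : WordExpr) :
    WordExpr :=
  ifEq A (num 0) (slots k * npow vectors a)
    (ifLt ((A - num 1) / Λ) (num k) (F ((A - num 1) / Λ) ((A - num 1) % Λ)) (num 0))

section eval

variable {x : OVInstance} {ρ μ : ℕ → ℕ} (hμ : ∀ i < x.input.length, μ i = x.input.getD i 0)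

include hμ

theorem eval_vectors : vectors.eval ρ μ = x.n := by
  have := hμ 0 (by rw [x.length_input]; omega)
  simpa [vectors, OVInstance.input] using this

theorem eval_dimension : dimension.eval ρ μ = x.d := by
  have := hμ 1 (by rw [x.length_input]; omega)
  simpa [dimension, OVInstance.input] using this

theorem eval_bit (v j : WordExpr) :
    (bit v j).eval ρ μ = x.bit (v.eval ρ μ) (j.eval ρ μ) := by
  simp only [bit, eval_ifLt, eval_add, eval_mul, eval_num, eval_load, eval_vectors hμ,
    eval_dimension hμ, OVInstance.bit]
  split_ifs with h
  · exact hμ _ (by rw [x.length_input]; exact h)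
  · rw [List.getD_eq_default]
    rw [x.length_input]; omega

theorem eval_slots (k : ℕ) : (slots k).eval ρ μ = x.slots k := by
  simp only [slots, eval_add, eval_mul, eval_num, eval_dimension hμ, OVInstance.slots]

theorem eval_entry (k : ℕ) (i v s : WordExpr) :
    (entry k i v s).eval ρ μ = x.entry k (i.eval ρ μ) (v.eval ρ μ) (s.eval ρ μ) := by
  simp only [entry, eval_ifEq, eval_add, eval_num, eval_div, eval_bit hμ, OVInstance.entry]
  rfl

theorem eval_symb (k : ℕ) (i s b : WordExpr) :
    (symb k i s b).eval ρ μ = x.symb k (i.eval ρ μ) (s.eval ρ μ) (b.eval ρ μ) := by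
  simp only [symb, eval_ifEq, eval_ifLt, eval_add, eval_num, eval_mul, eval_mod,
    eval_dimension hμ, OVInstance.symb]
  rfl

theorem eval_digitProd {B : WordExpr → WordExpr} {B' : ℕ → ℕ}
    (hB : ∀ v, (B v).eval ρ μ = B' (v.eval ρ μ)) (l : ℕ) (t : WordExpr) :
    (digitProd B l t).eval ρ μ = KSD.digitProd B' x.n l (t.eval ρ μ) := by
  induction l generalizing t with
  | zero => rfl
  | succ l ih =>
    simp only [digitProd, eval_mul, hB, ih, eval_div, eval_mod, eval_npow, eval_vectors hμ,
      KSD.digitProd]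

theorem eval_str (k a : ℕ) (i p : WordExpr) :
    (str k a i p).eval ρ μ = x.str k a (i.eval ρ μ) (p.eval ρ μ) := by
  rw [str, eval_symb hμ, eval_digitProd hμ (B' := fun v => x.entry k (i.eval ρ μ) v
    ((p / npow vectors a).eval ρ μ)) (fun v => eval_entry hμ k i v _)]
  simp only [eval_div, eval_mod, eval_npow, eval_vectors hμ, OVInstance.str]

theorem eval_slpSym (k : ℕ) (i l s c : WordExpr) : (slpSym k i l s c).eval ρ μ =
    x.slpSym k (i.eval ρ μ) (l.eval ρ μ) (s.eval ρ μ) (c.eval ρ μ) := by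
  simp only [slpSym, eval_ifEq, eval_add, eval_sub, eval_mul, eval_num, eval_symb hμ,
    eval_slots hμ, OVInstance.slpSym]

theorem eval_ruleSym (k : ℕ) (i r v : WordExpr) : (ruleSym k i r v).eval ρ μ =
    x.ruleSym k (i.eval ρ μ) (r.eval ρ μ) (v.eval ρ μ) := by
  simp only [ruleSym, eval_slpSym hμ, eval_div, eval_mod, eval_mul, eval_num, eval_slots hμ,
    eval_entry hμ, OVInstance.ruleSym]

theorem eval_codeLength (k a : ℕ) : (codeLength k a).eval ρ μ = x.codeLength k a := by
  simp only [codeLength, eval_add, eval_mul, eval_num, eval_vectors hμ, eval_slots hμ,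
    OVInstance.codeLength]

theorem eval_codeWord (k a : ℕ) (i r : WordExpr) :
    (codeWord k a i r).eval ρ μ = x.codeWord k a (i.eval ρ μ) (r.eval ρ μ) := by
  simp only [codeWord, eval_ifEq, eval_ifLt, eval_add, eval_sub, eval_mul, eval_div, eval_mod,
    eval_num, eval_vectors hμ, eval_slots hμ, eval_slpSym hμ, eval_ruleSym hμ,
    OVInstance.codeWord]

theorem eval_blockInput {α : Type} {k a Λ' : ℕ} {Λ : WordExpr}
    {F : WordExpr → WordExpr → WordExpr} (hΛ : Λ.eval ρ μ = Λ') (hΛ' : 0 < Λ') (g : Fin k → α)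
    (f : α → List ℕ) (hf : ∀ i, (f (g i)).length = Λ')
    (hF : ∀ (i : Fin k) (r : ℕ) (e e' : WordExpr), e.eval ρ μ = i → e'.eval ρ μ = r → r < Λ' →
      (F e e').eval ρ μ = (f (g i)).getD r 0) (A : WordExpr) :
    (blockInput k a Λ F A).eval ρ μ =
      (x.slots k * x.n ^ a :: (List.ofFn g).flatMap f).getD (A.eval ρ μ) 0 := by
  simp only [blockInput, eval_ifEq, eval_ifLt, eval_mul, eval_div, eval_sub, eval_num, eval_npow,
    eval_slots hμ, eval_vectors hμ, hΛ]
  rcases Nat.eq_zero_or_pos (A.eval ρ μ) with hA | hA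
  · rw [if_pos hA, hA, List.getD_cons_zero]
  · obtain ⟨B, hB⟩ := Nat.exists_eq_succ_of_ne_zero hA.ne'
    rw [if_neg hA.ne', hB, Nat.succ_eq_add_one, Nat.add_sub_cancel, List.getD_cons_succ,
      getD_flatMap_ofFn hΛ' g f hf]
    split_ifs with h
    · refine hF ⟨_, h⟩ _ _ _ ?_ ?_ (Nat.mod_lt _ hΛ')
      · simp only [eval_div, eval_sub, eval_num, hB, hΛ, Nat.succ_eq_add_one, Nat.add_sub_cancel]
      · simp only [eval_mod, eval_sub, eval_num, hB, hΛ, Nat.succ_eq_add_one, Nat.add_sub_cancel]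
    · rfl

theorem eval_input_sdInstance {k : ℕ} (hk : 2 ≤ k) (a : ℕ) (hn : 0 < x.n) (A : WordExpr) :
    (blockInput k a (slots k * npow vectors a) (str k a) A).eval ρ μ =
      (x.sdInstance hk a).input.getD (A.eval ρ μ) 0 := by
  refine eval_blockInput hμ (Λ' := x.slots k * x.n ^ a) ?_
    (Nat.mul_pos (x.slots_pos k) (Nat.pow_pos hn)) _ _ (fun i => ?_)
    (fun i r e e' he he' hr => ?_) A
  · rw [eval_mul, eval_slots hμ, eval_npow, eval_vectors hμ]
  · simp [OVInstance.sdInstance]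
  · rw [eval_str hμ, he, he', List.getD_eq_getElem (l := List.ofFn _)
      (hn := by simpa [OVInstance.sdInstance] using hr)]
    simp [OVInstance.sdInstance]

theorem eval_input_compressedInstance {k : ℕ} (hk : 2 ≤ k) (a : ℕ) (hn : 0 < x.n)
    (A : WordExpr) :
    (blockInput k a (codeLength k a) (codeWord k a) A).eval ρ μ =
      (x.compressedInstance hk a hn).input.getD (A.eval ρ μ) 0 := by
  refine eval_blockInput hμ (eval_codeLength hμ k a) (by unfold OVInstance.codeLength; omega) _ _
    (fun i => x.length_code_slp hk a hn i) (fun i r e e' he he' hr => ?_) A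
  rw [eval_codeWord hμ, he, he']
  exact (x.getD_code_slp hk a hn i hr).symm

end eval

end WordExpr

/-! ### Sizes and exponents -/

namespace OVInstance

variable {k a : ℕ} (x : OVInstance)

theorem slots_le (hk : 2 ≤ k) {η : ℝ} (hη : 0 ≤ η) (hn : 0 < x.n)
    (hd : (x.d : ℝ) ≤ (x.n : ℝ) ^ η) : (x.slots k : ℝ) ≤ k * (x.n : ℝ) ^ η := by
  have h1 : (1 : ℝ) ≤ (x.n : ℝ) ^ η := Real.one_le_rpow (by exact_mod_cast hn) hη
  have hk1 : ((k - 1 : ℕ) : ℝ) = k - 1 := by rw [Nat.cast_sub (by omega), Nat.cast_one]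
  have hk2 : (2 : ℝ) ≤ k := by exact_mod_cast hk
  rw [slots, Nat.cast_add, Nat.cast_mul, hk1, Nat.cast_one]
  nlinarith

theorem length_le (hk : 2 ≤ k) {η : ℝ} (hη : 0 ≤ η) (hn : 0 < x.n)
    (hd : (x.d : ℝ) ≤ (x.n : ℝ) ^ η) (hlarge : (k : ℝ) ≤ (x.n : ℝ) ^ η) :
    ((x.slots k * x.n ^ a : ℕ) : ℝ) ≤ (x.n : ℝ) ^ ((a : ℝ) + 2 * η) := by
  have hn' : (0 : ℝ) < x.n := by exact_mod_cast hn
  have hpos : 0 < (x.n : ℝ) ^ η := Real.rpow_pos_of_pos hn' η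
  rw [Nat.cast_mul, Nat.cast_pow, Real.rpow_add hn', Real.rpow_natCast, two_mul,
    Real.rpow_add hn', mul_comm]
  refine mul_le_mul_of_nonneg_left ((x.slots_le hk hη hn hd).trans ?_) (by positivity)
  exact mul_le_mul_of_nonneg_right hlarge hpos.le

theorem le_length (ha : 1 ≤ a) : x.n ≤ x.slots k * x.n ^ a :=
  (Nat.le_self_pow (by omega) _).trans (Nat.le_mul_of_pos_left _ (x.slots_pos k))

/-- The straight-line programs have size `n ^ (1 + o(1))`, and the strings have length
`n ^ (a + o(1))`. -/
theorem sizeNear (hk : 2 ≤ k) (ha : 1 ≤ a) {η δ : ℝ} (hη : 0 ≤ η) (hδ : 2 * η ≤ δ)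
    (hn : 0 < x.n) (hd : (x.d : ℝ) ≤ (x.n : ℝ) ^ η)
    (hlarge : (k * (k + 4 * a + 4) : ℝ) ≤ (x.n : ℝ) ^ η) :
    (x.compressedInstance hk a hn).SizeNear (1 / a) δ := by
  intro i
  have hn' : (0 : ℝ) < x.n := by exact_mod_cast hn
  have hn1 : (1 : ℝ) ≤ x.n := by exact_mod_cast hn
  have ha' : (1 : ℝ) ≤ a := by exact_mod_cast ha
  have hk' : (2 : ℝ) ≤ k := by exact_mod_cast hk
  have hm1 : (1 : ℝ) ≤ x.slots k := by exact_mod_cast x.slots_pos k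
  have hk_le : (k : ℝ) ≤ (x.n : ℝ) ^ η := by nlinarith
  have hsize := x.size_slp hk a hn i
  have hsize' : (((x.compressedInstance hk a hn).G i).size : ℝ) =
      k + 2 + (2 * x.slots k * a + 1) + (2 * x.slots k * a * x.n + x.slots k) := by
    rw [show ((x.compressedInstance hk a hn).G i).size = (x.slp hk a hn i).size from rfl, hsize]
    push_cast
    ring
  have hN : (((x.compressedInstance hk a hn).N : ℕ) : ℝ) = ((x.slots k * x.n ^ a : ℕ) : ℝ) := rfl
  have hNn : (x.n : ℝ) ^ (a : ℝ) ≤ ((x.slots k * x.n ^ a : ℕ) : ℝ) := by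
    rw [Real.rpow_natCast, Nat.cast_mul, Nat.cast_pow]
    exact le_mul_of_one_le_left (by positivity) hm1
  have hNle := x.length_le (a := a) hk hη hn hd hk_le
  rw [hsize', hN]
  generalize ((x.slots k * x.n ^ a : ℕ) : ℝ) = N at hNn hNle
  have hN1 : 1 ≤ N := (Real.one_le_rpow hn1 (by positivity)).trans hNn
  constructor
  · have h1 : N ^ (1 / (a : ℝ) - δ) ≤ x.n := by
      rcases le_total (1 / (a : ℝ) - δ) 0 with hneg | hpos
      · exact (Real.rpow_le_one_of_one_le_of_nonpos hN1 hneg).trans hn1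
      · calc N ^ (1 / (a : ℝ) - δ) ≤ ((x.n : ℝ) ^ ((a : ℝ) + 2 * η)) ^ (1 / (a : ℝ) - δ) :=
              Real.rpow_le_rpow (by linarith) hNle hpos
          _ = (x.n : ℝ) ^ (((a : ℝ) + 2 * η) * (1 / (a : ℝ) - δ)) :=
              (Real.rpow_mul hn'.le _ _).symm
          _ ≤ (x.n : ℝ) ^ (1 : ℝ) := by
              refine Real.rpow_le_rpow_of_exponent_le hn1 ?_
              have h2 : (a : ℝ) * (1 / a) = 1 := by field_simp
              have h3 : 1 / (a : ℝ) ≤ 1 := by rw [div_le_one (by linarith)]; exact ha'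
              nlinarith [mul_nonneg hη (show 0 ≤ δ by linarith),
                mul_nonneg (sub_nonneg.mpr ha') (show 0 ≤ δ by linarith)]
          _ = x.n := Real.rpow_one _
    have h2 : (x.n : ℝ) ≤ x.slots k * a * x.n := by
      refine le_mul_of_one_le_left hn'.le ?_
      nlinarith
    have h3 : (0 : ℝ) ≤ x.slots k * a := by positivity
    nlinarith
  · have h1 : (1 : ℝ) ≤ x.slots k * x.n := by nlinarith
    have hmn : (x.slots k : ℝ) ≤ x.slots k * x.n := le_mul_of_one_le_right (by linarith) hn1
    have h2 : k + 2 + (2 * x.slots k * a + 1) + (2 * x.slots k * a * x.n + x.slots k) ≤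
        (k + 4 * a + 4) * ((x.slots k : ℝ) * x.n) := by
      nlinarith
    have h3 : (k + 4 * a + 4) * ((x.slots k : ℝ) * x.n) ≤ (x.n : ℝ) ^ (1 + 2 * η) := by
      have hs := x.slots_le hk hη hn hd
      have hpos : 0 < (x.n : ℝ) ^ η := Real.rpow_pos_of_pos hn' η
      rw [Real.rpow_add hn', Real.rpow_one, two_mul, Real.rpow_add hn']
      calc (k + 4 * a + 4) * ((x.slots k : ℝ) * x.n)
          ≤ (k + 4 * a + 4) * ((k * (x.n : ℝ) ^ η) * x.n) := by gcongr
        _ = x.n * ((k * (k + 4 * a + 4)) * (x.n : ℝ) ^ η) := by ring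
        _ ≤ x.n * ((x.n : ℝ) ^ η * (x.n : ℝ) ^ η) := by gcongr
    refine h2.trans (h3.trans ?_)
    calc (x.n : ℝ) ^ (1 + 2 * η) ≤ (x.n : ℝ) ^ ((a : ℝ) * (1 / a + δ)) := by
          refine Real.rpow_le_rpow_of_exponent_le hn1 ?_
          have h2 : (a : ℝ) * (1 / a) = 1 := by field_simp
          nlinarith
      _ = ((x.n : ℝ) ^ (a : ℝ)) ^ (1 / (a : ℝ) + δ) := Real.rpow_mul hn'.le _ _
      _ ≤ N ^ (1 / (a : ℝ) + δ) :=
          Real.rpow_le_rpow (by positivity) hNn (by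
            have : 0 ≤ 1 / (a : ℝ) := by positivity
            linarith)

theorem length_add_two_le (hd : x.d ≤ x.n) :
    x.slots k * x.n ^ a + 2 ≤ (x.n + 2) ^ (a + k + 2) := by
  have h1 : x.slots k ≤ (x.n + 1) * (k + 1) := by
    unfold slots
    have := Nat.mul_le_mul hd (show k - 1 ≤ k by omega)
    nlinarith
  have h2 : k + 1 ≤ (x.n + 2) ^ k :=
    (Nat.lt_pow_self (by omega : 1 < x.n + 2))
  have h3 : x.n ^ a ≤ (x.n + 2) ^ a := Nat.pow_le_pow_left (by omega) a
  have h4 : 1 ≤ (x.n + 2) ^ a * (x.n + 2) ^ k :=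
    Nat.mul_pos (Nat.pow_pos (by omega)) (Nat.pow_pos (by omega))
  calc x.slots k * x.n ^ a + 2
      ≤ ((x.n + 1) * (x.n + 2) ^ k) * (x.n + 2) ^ a + 2 := by
        have := Nat.mul_le_mul (h1.trans (Nat.mul_le_mul_left _ h2)) h3
        omega
    _ = (x.n + 1) * ((x.n + 2) ^ a * (x.n + 2) ^ k) + 2 := by ring
    _ ≤ (x.n + 2) * (x.n + 2) * ((x.n + 2) ^ a * (x.n + 2) ^ k) := by
        have := Nat.mul_le_mul_right ((x.n + 2) ^ a * (x.n + 2) ^ k)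
          (show (x.n + 1) + 2 ≤ (x.n + 2) * (x.n + 2) by nlinarith)
        rw [Nat.add_mul] at this
        omega
    _ = (x.n + 2) ^ (a + k + 2) := by ring

end OVInstance

/-- The reduction for both input formats: `Q` computes the words of the instances that belong to the
instances of orthogonal vectors. -/
theorem not_solvableInTime_of_words {a k : ℕ} (ha : 1 ≤ a) (hk : 2 ≤ k)
    (hOV : OVHypothesis (a * (k - 1))) {ε δ : ℝ} (hε : 0 < ε) (hδ : 0 < δ)
    {J : Type} {dom : J → Prop} {size : J → ℕ} {input : J → List ℕ} {correct : J → ℕ → Prop}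
    (Q : WordExpr → WordExpr)
    (hJ : ∀ (x : OVInstance) (hn : 0 < x.n), ∃ y : J, size y = x.slots k * x.n ^ a ∧
      ((x.compressedInstance hk a hn).SizeNear (1 / a) δ → dom y) ∧
      (∀ b, correct y b → b = shiftDistance (x.sdInstance hk a).X) ∧
      ∀ ρ μ, (∀ i < x.input.length, μ i = x.input.getD i 0) →
        ∀ e, (Q e).eval ρ μ = (input y).getD (e.eval ρ μ) 0) :
    ¬ SolvableInTime dom size input correct ((k : ℝ) - 1 - ε) := by
  intro h
  have hk' : (2 : ℝ) ≤ k := by exact_mod_cast hk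
  have ha' : (1 : ℝ) ≤ a := by exact_mod_cast ha
  -- A negative exponent of `N` is avoided by passing from `ε` to `ε₀ ≤ 1`.
  set ε₀ := min ε 1 with hε₀
  have hε₀pos : 0 < ε₀ := lt_min hε one_pos
  have hε₀1 : ε₀ ≤ 1 := min_le_right _ _
  have hε₀ε : ε₀ ≤ ε := min_le_left _ _
  -- The dimension is at most `n ^ η`, and constants are absorbed by another factor `n ^ η`.
  set η := min (δ / 2) (ε₀ / (4 * k)) with hηdef
  have hη : 0 < η := lt_min (by positivity) (by positivity)
  have hηδ : 2 * η ≤ δ := by linarith [min_le_left (δ / 2) (ε₀ / (4 * k))]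
  have hηε : η * (4 * k) ≤ ε₀ := (le_div_iff₀ (by positivity)).mp (min_le_right _ _)
  have hη1 : η ≤ 1 := by nlinarith
  obtain ⟨n₁, hn₁⟩ := Filter.eventually_atTop.mp
    (((tendsto_rpow_atTop hη).comp tendsto_natCast_atTop_atTop).eventually_ge_atTop
      (k * (k + 4 * a + 4) : ℝ))
  have hK : ((a * (k - 1) : ℕ) : ℝ) = a * (k - 1) := by
    rw [Nat.cast_mul, Nat.cast_sub (by omega), Nat.cast_one]
  refine hOV (ε₀ / 2) η (by positivity) hη (h.of_lazy
    (.num 2 + .vectors * .dimension) Q (.var 0 - .dimension) (a + k + 2) (n₁ + 1) 1 ?_ (by omega)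
    (fun x ρ μ hμ => ?_) (fun x hx hxn i => ?_) fun x hx hxn => ?_)
  · rw [hK]; nlinarith
  · rw [WordExpr.eval_add, WordExpr.eval_mul, WordExpr.eval_vectors hμ,
      WordExpr.eval_dimension hμ, x.length_input, WordExpr.eval_num]
  all_goals
    have hn : 0 < x.n := by omega
    have hn1 : (1 : ℝ) ≤ x.n := by exact_mod_cast hn
    have hd : x.d ≤ x.n := by
      have : (x.n : ℝ) ^ η ≤ (x.n : ℝ) ^ (1 : ℝ) := Real.rpow_le_rpow_of_exponent_le hn1 hη1
      rw [Real.rpow_one] at this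
      exact_mod_cast hx.trans this
  · refine (x.getD_input_lt i).trans_le ?_
    calc x.n + x.d + 2 ≤ (x.n + 2) ^ 2 := by nlinarith
      _ ≤ _ := Nat.pow_le_pow_right (by omega) (by omega)
  · have hlarge : (k * (k + 4 * a + 4) : ℝ) ≤ (x.n : ℝ) ^ η := hn₁ x.n (by omega)
    obtain ⟨y, hy, hdom, hcorrect, hQ⟩ := hJ x hn
    refine ⟨y, hdom (x.sizeNear hk ha hη.le hηδ hn hx hlarge), ?_, ?_, ?_,
      fun ρ μ hμ => ⟨hQ ρ μ hμ, fun hb => ?_⟩⟩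
    · rw [hy]; exact x.le_length ha
    · rw [hy]; exact x.length_add_two_le hd
    · rw [hy, one_mul]
      have hN1 : (1 : ℝ) ≤ ((x.slots k * x.n ^ a : ℕ) : ℝ) := by
        exact_mod_cast hn.trans_le (x.le_length (k := k) ha)
      have hNle := x.length_le (a := a) hk hη.le hn hx (by nlinarith)
      calc ((x.slots k * x.n ^ a : ℕ) : ℝ) ^ ((k : ℝ) - 1 - ε)
          ≤ ((x.slots k * x.n ^ a : ℕ) : ℝ) ^ ((k : ℝ) - 1 - ε₀) :=
            Real.rpow_le_rpow_of_exponent_le hN1 (by linarith)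
        _ ≤ ((x.n : ℝ) ^ ((a : ℝ) + 2 * η)) ^ ((k : ℝ) - 1 - ε₀) :=
            Real.rpow_le_rpow (by linarith) hNle (by linarith)
        _ = (x.n : ℝ) ^ (((a : ℝ) + 2 * η) * ((k : ℝ) - 1 - ε₀)) :=
            (Real.rpow_mul (by linarith) _ _).symm
        _ ≤ (x.n : ℝ) ^ (((a * (k - 1) : ℕ) : ℝ) - ε₀ / 2) := by
            refine Real.rpow_le_rpow_of_exponent_le hn1 ?_
            rw [hK]
            nlinarith [mul_pos hη hε₀pos]
    · have hb' := hcorrect _ hb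
      rw [WordExpr.eval_sub, WordExpr.eval_var, WordExpr.eval_dimension hμ,
        ← x.lt_shiftDistance_iff hk a hn, ← hb']
      omega

end KSD

theorem mainTheorem10 (a k : ℕ) (ha : 1 ≤ a) (hk : 2 ≤ k)
    (hOV : KSD.OVHypothesis (a * (k - 1))) :
    ∃ σ : ℕ, ∀ ε δ : ℝ, 0 < ε → 0 < δ →
      ¬ KSD.SolvableFromStrings k σ (1 / (a : ℝ)) δ ((k : ℝ) - 1 - ε) ∧
      ¬ KSD.SolvableFromSLPs k σ (1 / (a : ℝ)) δ ((k : ℝ) - 1 - ε) := by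
  refine ⟨k + 2, fun ε δ hε hδ => ⟨?_, ?_⟩⟩
  · exact KSD.not_solvableInTime_of_words ha hk hOV hε hδ _ fun x hn =>
      ⟨x.sdInstance hk a, rfl, fun h => ⟨x.compressedInstance hk a hn, rfl, h⟩, fun _ h => h,
        fun _ _ hμ => KSD.WordExpr.eval_input_sdInstance hμ hk a hn⟩
  · exact KSD.not_solvableInTime_of_words ha hk hOV hε hδ _ fun x hn =>
      ⟨x.compressedInstance hk a hn, rfl, id, fun _ h => h,
        fun _ _ hμ => KSD.WordExpr.eval_input_compressedInstance hμ hk a hn⟩
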